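/- Let $F=\mathbb{R}$ or $\mathbb{C}$ and let $n\ge 0$ be an integer. Let $G_n=SL(n,F)$, let $N_n\subset G_n$ be the group of upper triangular matrices with ones on the main diagonal, $\bar N_n=N_n^{T}$, $A_n$ the group of diagonal matrices in $G_n$ with positive real entries, and $K_n=SO(n)$ if $F=\mathbb{R}$, $K_n=SU(n)$ if $F=\mathbb{C}$. For $g\in G_n$ let $g=\bar n(g)\,a_n(g)\,k_n(g)$ be its Iwasawa decomposition with respect to $G_n=\bar N_nA_nK_n$. For a linear form $\lambda$ on real diagonal matrices put $a^{\lambda}=e^{\lambda(\log a)}$. Let $$\rho_n(H)=\tfrac12\operatorname{tr}_{\mathbb{R}}\bigl(\operatorname{ad}H|_{\mathrm{Lie}(N_n)}\bigr)=\frac{\dim_{\mathbb{R}}F}{2}\sum_{1\le i<j\le n}(H_i-H_j),\qquad \Lambda_{n-1}(H)=H_1+\cdots+H_{n-1}$$ for $H=\operatorname{diag}(H_1,\dots,H_n)$; $\Lambda_{n-1}$ is the highest weight of the $(n-1)$-st exterior power of the standard representation. Let $dv$ be a Haar measure on the commutator subgroup $[N_n,N_n]$. (1) If $n\ge 3$ and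 $0\le\alpha<1$, then for every $r\in\mathbb{R}$ $$\int_{[N_n,N_n]}a_n(v)^{-\rho_n}\,a_n(v)^{\alpha(\dim_{\mathbb{R}}F)\Lambda_{n-1}}\,\bigl(1+\rho_n(\log a_n(v))\bigr)^{r}\,dv<\infty .$$ (2) Consequently $SL(n,F)$ is tame for every $n$, that is, $$\int_{[N_n,N_n]}a_n(v)^{-\rho_n}\bigl(1+\log a_n(v)^{\rho_n}\bigr)^{d}\,dv<\infty\quad\text{for all } d>0 .$$ (3) $GL(n,F)$ is tame for every $n$: the assertion of (2) holds when $G_n$ is replaced by $GL(n,F)$, $N_n$ by the upper triangular matrices in $GL(n,F)$ with ones on the diagonal, $A_n$ by all diagonal matrices with positive real entries, and $K_n$ by $O(n)$ or $U(n)$. -/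

import Mathlib

open MeasureTheory Matrix

namespace SLTame

/-- Upper triangular matrices with ones on the main diagonal. -/
def IsUpperUnipotent {n : ℕ} {F : Type*} [RCLike F] (M : Matrix (Fin n) (Fin n) F) : Prop :=
  (∀ i, M i i = 1) ∧ ∀ i j, j < i → M i j = 0

theorem IsUpperUnipotent.one {n : ℕ} {F : Type*} [RCLike F] :
    IsUpperUnipotent (1 : Matrix (Fin n) (Fin n) F) :=
  ⟨fun i => Matrix.one_apply_eq i, fun _ _ h => Matrix.one_apply_ne h.ne'⟩

theorem IsUpperUnipotent.mul {n : ℕ} {F : Type*} [RCLike F] {M M' : Matrix (Fin n) (Fin n) F}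
    (h : IsUpperUnipotent M) (h' : IsUpperUnipotent M') : IsUpperUnipotent (M * M') := by
  constructor
  · intro i
    rw [Matrix.mul_apply, Finset.sum_eq_single i]
    · rw [h.1, h'.1, one_mul]
    · intro j _ hj
      rcases lt_or_gt_of_ne hj with hj | hj
      · rw [h.2 i j hj, zero_mul]
      · rw [h'.2 j i hj, mul_zero]
    · simp
  · intro i j hij
    rw [Matrix.mul_apply]
    refine Finset.sum_eq_zero fun k _ => ?_
    rcases lt_or_ge k i with hk | hk
    · rw [h.2 i k hk, zero_mul]
    · rw [h'.2 k j (hij.trans_le hk), mul_zero]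

theorem IsUpperUnipotent.det {n : ℕ} {F : Type*} [RCLike F] {M : Matrix (Fin n) (Fin n) F}
    (h : IsUpperUnipotent M) : M.det = 1 := by
  have ht : M.BlockTriangular id := fun i j hij => h.2 i j hij
  rw [Matrix.det_of_isUpperTriangular ht]
  simp [h.1]

theorem IsUpperUnipotent.inv {n : ℕ} {F : Type*} [RCLike F] {M : Matrix (Fin n) (Fin n) F}
    (h : IsUpperUnipotent M) : IsUpperUnipotent M⁻¹ := by
  have hu : IsUnit M.det := by rw [h.det]; exact isUnit_one
  have : Invertible M := Matrix.invertibleOfIsUnitDet M hu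
  have ht : M.BlockTriangular id := fun i j hij => h.2 i j hij
  have hti : M⁻¹.BlockTriangular id := Matrix.blockTriangular_inv_of_blockTriangular ht
  refine ⟨fun i => ?_, fun i j hij => hti hij⟩
  have h1 : (M * M⁻¹) i i = 1 := by rw [Matrix.mul_nonsing_inv M hu, Matrix.one_apply_eq]
  rw [Matrix.mul_apply, Finset.sum_eq_single i] at h1
  · rwa [h.1, one_mul] at h1
  · intro j _ hj
    rcases lt_or_gt_of_ne hj with hj | hj
    · rw [h.2 i j hj, zero_mul]
    · rw [hti hj, mul_zero]
  · simp

/-- The group `N` of upper triangular matrices with ones on the diagonal, in `GL(n, F)`. -/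
def upperUnipotentGL (n : ℕ) (F : Type*) [RCLike F] : Subgroup (GL (Fin n) F) where
  carrier := {g | IsUpperUnipotent (g : Matrix (Fin n) (Fin n) F)}
  one_mem' := by simpa using IsUpperUnipotent.one
  mul_mem' := by
    intro a b ha hb
    simpa using IsUpperUnipotent.mul ha hb
  inv_mem' := by
    intro a ha
    simpa [Matrix.coe_units_inv] using IsUpperUnipotent.inv ha

/-- The group `N` of upper triangular matrices with ones on the diagonal, in `SL(n, F)`. -/
def upperUnipotentSL (n : ℕ) (F : Type*) [RCLike F] :
    Subgroup (SpecialLinearGroup (Fin n) F) :=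
  (upperUnipotentGL n F).comap SpecialLinearGroup.toGL

/-- `g = nbar * diag(a) * k` is an Iwasawa decomposition of `g` along
`(lower unipotent) · (positive diagonal) · (orthogonal or unitary)`. -/
structure IsIwasawa {n : ℕ} {F : Type*} [RCLike F] (g nbar : Matrix (Fin n) (Fin n) F)
    (a : Fin n → ℝ) (k : Matrix (Fin n) (Fin n) F) : Prop where
  lower : IsUpperUnipotent nbarᵀ
  pos : ∀ i, 0 < a i
  unitary : k ∈ Matrix.unitaryGroup (Fin n) F
  eq : g = nbar * Matrix.diagonal (fun i => (a i : F)) * k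

theorem gramSchmidt_repr_self {F E : Type*} [RCLike F] [NormedAddCommGroup E]
    [InnerProductSpace F E] {n : ℕ} (b : Module.Basis (Fin n) F E) (i : Fin n) :
    b.repr (InnerProductSpace.gramSchmidt F b i) i = 1 := by
  rw [InnerProductSpace.gramSchmidt_def, map_sub, map_sum, Finsupp.sub_apply,
    Finsupp.finsetSum_apply, Finset.sum_eq_zero, sub_zero]
  · simp
  · intro j hj
    obtain ⟨c, hc⟩ := Submodule.mem_span_singleton.1
      (Submodule.starProjection_apply_mem
        (Submodule.span F {InnerProductSpace.gramSchmidt F b j}) (b i))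
    rw [← hc, map_smul, Finsupp.smul_apply,
      InnerProductSpace.gramSchmidt_triangular (Finset.mem_Iio.1 hj), smul_zero]

open scoped ComplexOrder in
theorem exists_isIwasawa {n : ℕ} {F : Type*} [RCLike F] (g : GL (Fin n) F) :
    ∃ nbar a k, IsIwasawa (g : Matrix (Fin n) (Fin n) F) nbar a k := by
  set G : Matrix (Fin n) (Fin n) F := (g : Matrix (Fin n) (Fin n) F) with hG
  have hGu : IsUnit G := g.isUnit
  have hS : (G * Gᴴ).PosDef :=
    Matrix.PosDef.mul_conjTranspose_self G (Matrix.vecMul_injective_of_isUnit hGu)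
  set L := LDL.lowerInv hS with hLdef
  have hLu : IsUnit L := @isUnit_of_invertible _ _ _ (LDL.invertibleLowerInv hS)
  have hL : IsUpperUnipotent Lᵀ := by
    refine ⟨fun i => ?_, fun i j hij => LDL.lowerInv_triangular hS hij⟩
    have h1 := @gramSchmidt_repr_self F (Fin n → F) _ ((G * Gᴴ)ᵀ.toNormedAddCommGroup hS.transpose)
      ((G * Gᴴ)ᵀ.toInnerProductSpace hS.transpose.posSemidef) n (Pi.basisFun F (Fin n)) i
    rw [Pi.basisFun_repr] at h1
    exact h1
  have hdiag : LDL.diag hS = L * (G * Gᴴ) * Lᴴ := LDL.diag_eq_lowerInv_conj hS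
  have hD : (LDL.diag hS).PosDef := by
    rw [hdiag]
    have := (Matrix.IsUnit.posDef_star_right_conjugate_iff (x := G * Gᴴ) hLu).2 hS
    simpa [Matrix.star_eq_conjTranspose] using this
  have hpos : ∀ i, 0 < LDL.diagEntries hS i := by
    intro i
    have := hD.diag_pos (i := i)
    simpa [LDL.diag] using this
  have hre : ∀ i, 0 < RCLike.re (LDL.diagEntries hS i) := fun i => (RCLike.pos_iff.1 (hpos i)).1
  have hent : ∀ i, ((RCLike.re (LDL.diagEntries hS i) : ℝ) : F) = LDL.diagEntries hS i :=
    fun i => RCLike.conj_eq_iff_re.1 (RCLike.conj_eq_iff_im.2 (RCLike.pos_iff.1 (hpos i)).2)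
  set a : Fin n → ℝ := fun i => Real.sqrt (RCLike.re (LDL.diagEntries hS i)) with ha
  have hapos : ∀ i, 0 < a i := fun i => Real.sqrt_pos.2 (hre i)
  have hane : ∀ i, (a i : F) ≠ 0 := fun i => by exact_mod_cast (hapos i).ne'
  have hLdet : IsUnit L.det := (Matrix.isUnit_iff_isUnit_det _).1 hLu
  refine ⟨L⁻¹, a, Matrix.diagonal (fun i => ((a i : F))⁻¹) * (L * G), ?_, hapos, ?_, ?_⟩
  · rw [Matrix.transpose_nonsing_inv]
    exact hL.inv
  · rw [Matrix.mem_unitaryGroup_iff, Matrix.star_eq_conjTranspose, Matrix.conjTranspose_mul,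
      Matrix.conjTranspose_mul, Matrix.diagonal_conjTranspose]
    have h3 : Matrix.diagonal (fun i => ((a i : F))⁻¹) * (L * G) *
        (Gᴴ * Lᴴ * Matrix.diagonal (star fun i => ((a i : F))⁻¹)) =
        Matrix.diagonal (fun i => ((a i : F))⁻¹) * LDL.diag hS *
          Matrix.diagonal (star fun i => ((a i : F))⁻¹) := by
      rw [hdiag]; simp only [Matrix.mul_assoc]
    rw [h3, LDL.diag, Matrix.diagonal_mul_diagonal, Matrix.diagonal_mul_diagonal,
      ← Matrix.diagonal_one]
    congr 1
    funext i
    have h4 : LDL.diagEntries hS i = (a i : F) * (a i : F) := by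
      rw [← hent i, ← RCLike.ofReal_mul, ha]
      simp only
      rw [Real.mul_self_sqrt (hre i).le]
    have h5 : star ((a i : F))⁻¹ = ((a i : F))⁻¹ := by
      rw [star_inv₀, RCLike.star_def, RCLike.conj_ofReal]
    rw [Pi.star_apply, h5, h4]
    field_simp [hane i]
  · have h6 : Matrix.diagonal (fun i => (a i : F)) * Matrix.diagonal (fun i => ((a i : F))⁻¹)
        = 1 := by
      rw [Matrix.diagonal_mul_diagonal, ← Matrix.diagonal_one]
      congr 1
      funext i
      exact mul_inv_cancel₀ (hane i)
    rw [Matrix.mul_assoc, ← Matrix.mul_assoc (Matrix.diagonal _), h6, Matrix.one_mul,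
      ← Matrix.mul_assoc, Matrix.nonsing_inv_mul _ hLdet, Matrix.one_mul]

/-- The positive diagonal part of an Iwasawa decomposition is unique. -/
theorem IsIwasawa.unique {n : ℕ} {F : Type*} [RCLike F] {g nbar nbar' : Matrix (Fin n) (Fin n) F}
    {a a' : Fin n → ℝ} {k k' : Matrix (Fin n) (Fin n) F}
    (h : IsIwasawa g nbar a k) (h' : IsIwasawa g nbar' a' k') : a = a' := by
  have key : ∀ {m : Matrix (Fin n) (Fin n) F} {b : Fin n → ℝ} {l : Matrix (Fin n) (Fin n) F},
      IsIwasawa g m b l → g * gᴴ = m * Matrix.diagonal (fun i => (b i : F) * (b i : F)) * mᴴ := by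
    intro m b l hm
    have hl : l * lᴴ = 1 := Matrix.mem_unitaryGroup_iff.1 hm.unitary
    have hd : (Matrix.diagonal (fun i => (b i : F)))ᴴ = Matrix.diagonal (fun i => (b i : F)) := by
      rw [Matrix.diagonal_conjTranspose]
      congr 1
      funext i
      simp
    rw [hm.eq, Matrix.conjTranspose_mul, Matrix.conjTranspose_mul, hd,
      ← Matrix.diagonal_mul_diagonal]
    calc m * Matrix.diagonal (fun i => (b i : F)) * l *
          (lᴴ * (Matrix.diagonal (fun i => (b i : F)) * mᴴ))
        = m * Matrix.diagonal (fun i => (b i : F)) * (l * lᴴ) *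
          (Matrix.diagonal (fun i => (b i : F)) * mᴴ) := by simp only [Matrix.mul_assoc]
      _ = _ := by rw [hl, Matrix.mul_one]; simp only [Matrix.mul_assoc]
  have hdet' : IsUnit nbar'.det := by
    rw [← Matrix.det_transpose, h'.lower.det]; exact isUnit_one
  have hdetc : IsUnit (nbarᴴ).det := by
    rw [Matrix.det_conjTranspose, ← Matrix.det_transpose, h.lower.det]; simp
  have e := (key h).symm.trans (key h')
  set D : Matrix (Fin n) (Fin n) F := Matrix.diagonal (fun i => (a i : F) * (a i : F)) with hD
  set D' : Matrix (Fin n) (Fin n) F := Matrix.diagonal (fun i => (a' i : F) * (a' i : F)) with hD'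
  have e2 : nbar'⁻¹ * nbar * D = D' * (nbar'ᴴ * (nbarᴴ)⁻¹) := by
    calc nbar'⁻¹ * nbar * D = nbar'⁻¹ * (nbar * D * nbarᴴ) * (nbarᴴ)⁻¹ := by
          rw [Matrix.mul_assoc, Matrix.mul_assoc _ _ (nbarᴴ)⁻¹,
            Matrix.mul_assoc (nbar * D), Matrix.mul_nonsing_inv _ hdetc, Matrix.mul_one]
      _ = nbar'⁻¹ * (nbar' * (D' * nbar'ᴴ)) * (nbarᴴ)⁻¹ := by rw [e, Matrix.mul_assoc nbar']
      _ = _ := by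
          rw [← Matrix.mul_assoc nbar'⁻¹, Matrix.nonsing_inv_mul _ hdet', Matrix.one_mul,
            Matrix.mul_assoc]
  have hlow : IsUpperUnipotent (nbar'⁻¹ * nbar)ᵀ := by
    rw [Matrix.transpose_mul, Matrix.transpose_nonsing_inv]
    exact h.lower.mul h'.lower.inv
  have hconj : ∀ {m : Matrix (Fin n) (Fin n) F}, IsUpperUnipotent mᵀ → IsUpperUnipotent mᴴ := by
    intro m hm
    refine ⟨fun i => ?_, fun i j hij => ?_⟩
    · have := hm.1 i
      rw [Matrix.transpose_apply] at this
      rw [Matrix.conjTranspose_apply, this, star_one]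
    · have := hm.2 i j hij
      rw [Matrix.transpose_apply] at this
      rw [Matrix.conjTranspose_apply, this, star_zero]
  have hup : IsUpperUnipotent (nbar'ᴴ * (nbarᴴ)⁻¹) :=
    (hconj h'.lower).mul (hconj h.lower).inv
  funext i
  have e3 := congrFun (congrFun e2 i) i
  have h1 : (nbar'⁻¹ * nbar) i i = 1 := hlow.1 i
  rw [hD, hD', Matrix.mul_diagonal, Matrix.diagonal_mul, h1, hup.1 i, one_mul, mul_one] at e3
  have e4 : a i * a i = a' i * a' i := by exact_mod_cast e3
  exact (mul_self_inj (h.pos i).le (h'.pos i).le).1 e4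

/-- For `g` in `SL(n, F)` all three Iwasawa factors have determinant one, so that the decomposition
is the one of `SL(n, F)`, with third factor in `SO(n)` or `SU(n)`. -/
theorem IsIwasawa.det_eq_one {n : ℕ} {F : Type*} [RCLike F]
    {g nbar : Matrix (Fin n) (Fin n) F} {a : Fin n → ℝ} {k : Matrix (Fin n) (Fin n) F}
    (h : IsIwasawa g nbar a k) (hg : g.det = 1) :
    nbar.det = 1 ∧ (Matrix.diagonal (fun i => (a i : F))).det = 1 ∧ k.det = 1 := by
  have h1 : nbar.det = 1 := by rw [← Matrix.det_transpose, h.lower.det]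
  have h2 : (Matrix.diagonal (fun i => (a i : F))).det = ((∏ i, a i : ℝ) : F) := by
    rw [Matrix.det_diagonal]; push_cast; rfl
  have hp : 0 < ∏ i, a i := Finset.prod_pos fun i _ => h.pos i
  have h3 := congrArg Matrix.det h.eq
  rw [hg, Matrix.det_mul, Matrix.det_mul, h1, h2, one_mul] at h3
  have hk : ‖k.det‖ = 1 := by
    have := congrArg Matrix.det (Matrix.mem_unitaryGroup_iff.1 h.unitary)
    rw [Matrix.det_mul, Matrix.star_eq_conjTranspose, Matrix.det_conjTranspose, Matrix.det_one]
      at this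
    have h4 := congrArg norm this
    rw [norm_mul, norm_star, norm_one] at h4
    nlinarith [norm_nonneg k.det]
  have h5 := congrArg norm h3
  rw [norm_one, norm_mul, hk, mul_one, RCLike.norm_ofReal, abs_of_pos hp] at h5
  refine ⟨h1, ?_, ?_⟩
  · rw [h2, ← h5, RCLike.ofReal_one]
  · rw [← h5, RCLike.ofReal_one, one_mul] at h3
    exact h3.symm

/-- The diagonal entries of the component `a(g)` in the Iwasawa decomposition `g = nbar a(g) k`. -/
noncomputable def iwasawaA {n : ℕ} {F : Type*} [RCLike F] (g : GL (Fin n) F) : Fin n → ℝ :=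
  (exists_isIwasawa g).choose_spec.choose

theorem iwasawaA_spec {n : ℕ} {F : Type*} [RCLike F] (g : GL (Fin n) F) :
    ∃ nbar k, IsIwasawa (g : Matrix (Fin n) (Fin n) F) nbar (iwasawaA g) k :=
  ⟨_, (exists_isIwasawa g).choose_spec.choose_spec⟩

/-- `log a(g)`, as the vector of its diagonal entries. -/
noncomputable def logA {n : ℕ} {F : Type*} [RCLike F] (g : GL (Fin n) F) : Fin n → ℝ :=
  fun i => Real.log (iwasawaA g i)

/-- `a(g)^lam = exp (lam (log a(g)))`, for a linear form `lam` on real diagonal matrices. -/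
noncomputable def aPow {n : ℕ} {F : Type*} [RCLike F] (g : GL (Fin n) F)
    (lam : Module.Dual ℝ (Fin n → ℝ)) : ℝ :=
  Real.exp (lam (logA g))

/-- The form `ρ`, with `ρ(H) = (1/2) tr_ℝ (ad H | Lie N)`: the root spaces of `ad H` on `Lie N` are
the lines `F · E_{ij}`, `i < j`, of real dimension `dim_ℝ F`, with eigenvalue `H_i - H_j`. -/
noncomputable def rho (n : ℕ) (F : Type*) [RCLike F] : Module.Dual ℝ (Fin n → ℝ) :=
  (1 / 2 : ℝ) • ∑ p : Fin n × Fin n with p.1 < p.2,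
    (Module.finrank ℝ F : ℝ) •
      ((LinearMap.proj p.1 : (Fin n → ℝ) →ₗ[ℝ] ℝ) - (LinearMap.proj p.2 : (Fin n → ℝ) →ₗ[ℝ] ℝ))

/-- The fundamental weight `Λ_i`, the highest weight of the `i`-th exterior power of the standard
representation: `Λ_i(H) = H_1 + ⋯ + H_i` (the first `i` diagonal entries). -/
noncomputable def fundWeight (n i : ℕ) : Module.Dual ℝ (Fin n → ℝ) :=
  ∑ j : Fin n with j.val < i, (LinearMap.proj j : (Fin n → ℝ) →ₗ[ℝ] ℝ)

/-- The commutator subgroup `[N, N]` of `N`, inside `SL(n, F)`. -/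
abbrev commSL (n : ℕ) (F : Type*) [RCLike F] : Subgroup (SpecialLinearGroup (Fin n) F) :=
  ⁅upperUnipotentSL n F, upperUnipotentSL n F⁆

/-- The commutator subgroup `[N, N]` of `N`, inside `GL(n, F)`. -/
abbrev commGL (n : ℕ) (F : Type*) [RCLike F] : Subgroup (GL (Fin n) F) :=
  ⁅upperUnipotentGL n F, upperUnipotentGL n F⁆

/-- `SL(n, F)` is tame: `∫_{[N, N]} a(v)^{-ρ} (1 + log a(v)^ρ)^d dv < ∞` for all `d > 0`,
for any Haar measure `dv`. -/
def IsTameSL (n : ℕ) (F : Type*) [RCLike F] : Prop :=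
  ∀ [MeasurableSpace (commSL n F)]
    [BorelSpace (commSL n F)]
    (μ : Measure (commSL n F)) [μ.IsHaarMeasure] (d : ℝ), 0 < d →
    Integrable (fun v : (commSL n F) =>
      aPow (SpecialLinearGroup.toGL v.1) (-rho n F) *
        (1 + Real.log (aPow (SpecialLinearGroup.toGL v.1) (rho n F))) ^ d) μ

/-- `GL(n, F)` is tame: `∫_{[N, N]} a(v)^{-ρ} (1 + log a(v)^ρ)^d dv < ∞` for all `d > 0`,
for any Haar measure `dv`. -/
def IsTameGL (n : ℕ) (F : Type*) [RCLike F] : Prop :=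
  ∀ [MeasurableSpace (commGL n F)]
    [BorelSpace (commGL n F)]
    (μ : Measure (commGL n F)) [μ.IsHaarMeasure] (d : ℝ), 0 < d →
    Integrable (fun v : (commGL n F) =>
      aPow v.1 (-rho n F) * (1 + Real.log (aPow v.1 (rho n F))) ^ d) μ

end SLTame

/-! Write `d` for the real dimension of `F`. On trace-zero diagonal matrices `ρ` is `d` times the
sum of the fundamental weights `Λ_l` (`rho_eq_sum_fundWeight`). Each `Λ_l` is nonnegative at `log
a(v)` (`weight_nonneg`), so a power of `1 + ρ` costs only an arbitrarily small part of the
exponential decay. It remains to integrate `exp(-(d(1-η) ∑_{l<k} Λ_l + δ Λ_k))` over `[N, N]` in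
`SL(k+1, F)`, for every `δ > 0` and a suitable `η > 0`: this is `exists_lintegral_weight_lt_top`, by
induction on `k`.

`[N, N]` is the group of unipotent upper triangular matrices with zero superdiagonal (`mem_commSL`).
An element for `SL(k+2, F)` is therefore a corner `v` in the smaller group together with a last
column `v(y,0)`, `y ∈ F^k`, and Haar measure is a product in these coordinates
(`isHaarMeasure_map_columnChart`). If `K` is the unitary part of `v` and `z = K(y,0)`, then the new
column adds `½ log(1 + |z_1|² + ⋯ + |z_l|²)` to `Λ_l(v)` (`fundWeight_logA_border`).

The vector `z` runs over a hyperplane. Its first `k` coordinates are `Ty` with `det T = t =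
exp(-Λ_k(v))`, and its last one is `(c ⬝ Ty)/t` with `t² + |c|² = 1`. Passing to the coordinates
`Ty` costs `t^(-d)`, which would cancel the available decay in `Λ_k(v)`. The zero superdiagonal
entry rescues the estimate: a factor `|z_{k+1}|^(-ε)`, borrowed from the decay `δ` in the top
weight, yields `t^ε`, because `|c ⬝ x|^(-ε)` is locally integrable (`exists_lintegral_mulVec_le`).
Integration over `y` thus leaves the same kind of integrand for the corner, with `ε - dη` in the
role of `δ` (`exists_lintegral_columnChart_le`). -/

namespace SLTame

/-! ### Integrals of products of brackets over a hyperplane. -/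

section Analysis

variable {F : Type*} [RCLike F]

/-- The real Jacobian of an `F`-linear map is the norm from `F` to `ℝ` of its determinant, here a
real number `t`, so it is `t^d`. -/
theorem lintegral_comp_mulVec [MeasurableSpace F] [BorelSpace F] (ν : Measure F)
    [ν.IsAddHaarMeasure] {k : ℕ} (T : Matrix (Fin k) (Fin k) F) {t : ℝ} (ht : 0 < t)
    (hT : T.det = (t : F)) {f : (Fin k → F) → ENNReal} (hf : Measurable f) :
    ∫⁻ y, f (T *ᵥ y) ∂(Measure.pi fun _ => ν) =
      ENNReal.ofReal (t ^ (-(Module.finrank ℝ F : ℝ))) * ∫⁻ y, f y ∂(Measure.pi fun _ => ν) := by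
  have hdet : LinearMap.det ((Matrix.toLin' T).restrictScalars ℝ) = t ^ Module.finrank ℝ F := by
    rw [LinearMap.det_restrictScalars, LinearMap.det_toLin', hT]
    exact Algebra.norm_algebraMap t
  have hne : LinearMap.det ((Matrix.toLin' T).restrictScalars ℝ) ≠ 0 := by
    rw [hdet]; positivity
  have hmap := Measure.map_linearMap_addHaar_eq_smul_addHaar
    (Measure.pi fun _ : Fin k => ν) hne
  have hm : Measurable fun y : Fin k → F => T *ᵥ y :=
    (continuous_const.matrix_mulVec continuous_id).measurable
  rw [← lintegral_map hf hm]
  have : (fun y : Fin k → F => T *ᵥ y) = ⇑((Matrix.toLin' T).restrictScalars ℝ) := by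
    ext y; simp
  rw [this, hmap, lintegral_smul_measure, hdet, abs_of_pos (by positivity), Real.rpow_neg ht.le,
    Real.rpow_natCast, smul_eq_mul]

/-- A power of the Japanese bracket, decaying slightly faster than the dimension of `F`. -/
noncomputable def bracket (κ : ℝ) (x : F) : ENNReal :=
  ENNReal.ofReal ((1 + ‖x‖ ^ 2) ^ (-((Module.finrank ℝ F : ℝ) + κ) / 2))

theorem measurable_bracket [MeasurableSpace F] [BorelSpace F] (κ : ℝ) :
    Measurable (bracket κ : F → ENNReal) := by
  unfold bracket; fun_prop

theorem bracket_le_one {κ : ℝ} (hκ : 0 < κ) (x : F) : bracket κ x ≤ 1 := by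
  refine ENNReal.ofReal_le_one.2 (Real.rpow_le_one_of_one_le_of_nonpos ?_ ?_)
  · nlinarith [sq_nonneg ‖x‖]
  · have : (0 : ℝ) ≤ Module.finrank ℝ F := Nat.cast_nonneg _
    linarith

theorem bracket_anti {κ : ℝ} (hκ : 0 < κ) {x y : F} (h : ‖x‖ ≤ ‖y‖) :
    bracket κ y ≤ bracket κ x := by
  refine ENNReal.ofReal_le_ofReal (Real.rpow_le_rpow_of_nonpos (by positivity) (by gcongr) ?_)
  have : (0 : ℝ) ≤ Module.finrank ℝ F := Nat.cast_nonneg _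
  linarith

theorem lintegral_bracket_lt_top [MeasurableSpace F] [BorelSpace F] (ν : Measure F)
    [ν.IsAddHaarMeasure] {κ : ℝ} (hκ : 0 < κ) : ∫⁻ x, bracket κ x ∂ν < ⊤ := by
  have h := integrable_rpow_neg_one_add_norm_sq (E := F) (μ := ν)
    (r := (Module.finrank ℝ F : ℝ) + κ) (by linarith)
  exact h.lintegral_lt_top

/-- In polar coordinates the radial weight `y^(d-1)` is at most one on `(0,1)`, so the
one-dimensional condition `ε < 1` suffices for both fields. -/
theorem lintegral_ball_norm_rpow_lt_top [MeasurableSpace F] [BorelSpace F] (ν : Measure F)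
    [ν.IsAddHaarMeasure] {ε : ℝ} (h1 : ε < 1) :
    ∫⁻ x in Metric.ball (0 : F) 1, ‖x‖ₑ ^ (-ε) ∂ν < ⊤ := by
  have hi : IntegrableOn (fun x : F => ‖x‖ ^ (-ε)) (Metric.ball 0 1) ν := by
    rw [integrableOn_fun_norm_addHaar ν (f := fun y => y ^ (-ε))]
    have h2 : IntegrableOn (fun y : ℝ => y ^ (-ε)) (Set.Ioo 0 1) :=
      (intervalIntegral.integrableOn_Ioo_rpow_iff one_pos).2 (by linarith)
    refine h2.mono' ?_ ?_
    · exact Measurable.aestronglyMeasurable (by fun_prop)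
    · refine (ae_restrict_mem measurableSet_Ioo).mono fun y hy => ?_
      have hy0 : 0 ≤ y ^ (-ε) := Real.rpow_nonneg hy.1.le _
      rw [smul_eq_mul, norm_mul, norm_pow, Real.norm_of_nonneg hy.1.le, Real.norm_of_nonneg hy0]
      exact mul_le_of_le_one_left hy0 (pow_le_one₀ hy.1.le hy.2.le)
  refine lt_of_le_of_lt (le_of_eq ?_) hi.lintegral_lt_top
  refine lintegral_congr_ae (ae_restrict_of_ae ?_)
  have : ∀ᵐ x ∂ν, x ≠ (0 : F) := Measure.ae_ne ν 0
  refine this.mono fun x hx => ?_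
  dsimp only
  rw [← ofReal_norm, ENNReal.ofReal_rpow_of_pos (norm_pos_iff.2 hx)]

theorem lintegral_bracket_mul_lt_top [MeasurableSpace F] [BorelSpace F] (ν : Measure F)
    [ν.IsAddHaarMeasure] {κ ε : ℝ} (hκ : 0 < κ) (h0 : 0 < ε) (h1 : ε < 1) :
    ∫⁻ x, bracket κ x * ‖x‖ₑ ^ (-ε) ∂ν < ⊤ := by
  rw [← lintegral_add_compl _ (Metric.isOpen_ball (x := (0 : F)) (ε := 1)).measurableSet]
  refine ENNReal.add_lt_top.2 ⟨?_, ?_⟩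
  · refine lt_of_le_of_lt (lintegral_mono fun x => ?_) (lintegral_ball_norm_rpow_lt_top ν h1)
    exact mul_le_of_le_one_left (zero_le) (bracket_le_one hκ x)
  · refine lt_of_le_of_lt ?_ (lintegral_bracket_lt_top ν hκ)
    refine le_trans (setLIntegral_mono' Metric.isOpen_ball.measurableSet.compl
      (g := bracket κ) fun x hx => ?_) (setLIntegral_le_lintegral _ _)
    refine mul_le_of_le_one_right (zero_le) ?_
    have hx' : (1 : ENNReal) ≤ ‖x‖ₑ := by
      rw [← ofReal_norm, ← ENNReal.ofReal_one]
      exact ENNReal.ofReal_le_ofReal (by simpa using hx)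
    exact ENNReal.rpow_le_one_of_one_le_of_neg hx' (by linarith)

theorem lintegral_pi_prod {X : Type*} [MeasurableSpace X] (ν : Measure X) [SigmaFinite ν] {k : ℕ}
    (f : Fin k → X → ENNReal) (hf : ∀ i, Measurable (f i)) :
    ∫⁻ z, ∏ i, f i (z i) ∂(Measure.pi fun _ => ν) = ∏ i, ∫⁻ x, f i x ∂ν := by
  induction k with
  | zero => simp
  | succ k ih =>
    have h := (measurePreserving_piFinSuccAbove (fun _ : Fin (k + 1) => ν) 0).symm
    have hm : Measurable fun z : Fin (k + 1) → X => ∏ i, f i (z i) := by fun_prop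
    have hm' : Measurable fun z : Fin k → X => ∏ i, f i.succ (z i) :=
      Finset.measurable_fun_prod _ fun i _ => (hf _).comp (measurable_pi_apply i)
    rw [← h.lintegral_comp hm, Fin.prod_univ_succ, ← ih (fun i => f i.succ) fun i => hf _,
      ← lintegral_prod_mul (hf 0).aemeasurable
        hm'.aemeasurable]
    refine lintegral_congr fun p => ?_
    rw [Fin.prod_univ_succ]
    rfl

theorem lintegral_prod_bracket_lt_top [MeasurableSpace F] [BorelSpace F] (ν : Measure F)
    [ν.IsAddHaarMeasure] {κ : ℝ} (hκ : 0 < κ) (k : ℕ) :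
    ∫⁻ z : Fin k → F, ∏ i, bracket κ (z i) ∂(Measure.pi fun _ => ν) < ⊤ := by
  rw [lintegral_pi_prod ν (fun _ : Fin k => bracket κ) fun _ => measurable_bracket κ]
  exact ENNReal.prod_lt_top fun _ _ => lintegral_bracket_lt_top ν hκ

theorem lintegral_prod_bracket_mul_lt_top [MeasurableSpace F] [BorelSpace F] (ν : Measure F)
    [ν.IsAddHaarMeasure] {κ ε : ℝ} (hκ : 0 < κ) (h0 : 0 < ε) (h1 : ε < 1) {k : ℕ} (j : Fin k) :
    ∫⁻ z : Fin k → F, (∏ i, bracket κ (z i)) * ‖z j‖ₑ ^ (-ε) ∂(Measure.pi fun _ => ν) < ⊤ := by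
  have e : ∀ z : Fin k → F, (∏ i, bracket κ (z i)) * ‖z j‖ₑ ^ (-ε) =
      ∏ i, (fun x => bracket κ x * if i = j then ‖x‖ₑ ^ (-ε) else 1) (z i) := by
    intro z
    rw [Finset.prod_mul_distrib, Finset.prod_ite_eq' Finset.univ j (fun i => ‖z i‖ₑ ^ (-ε))]
    simp
  simp_rw [e]
  rw [lintegral_pi_prod ν
    (fun i x => bracket κ x * if i = j then ‖x‖ₑ ^ (-ε) else 1)]
  · refine ENNReal.prod_lt_top fun i _ => ?_
    by_cases hij : i = j
    · simpa [hij] using lintegral_bracket_mul_lt_top ν hκ h0 h1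
    · simpa [hij] using lintegral_bracket_lt_top ν hκ
  · intro i
    refine (measurable_bracket κ).mul ?_
    by_cases hij : i = j
    · simp only [hij, if_true]; fun_prop
    · simp [hij]

/-- Bracket and singular factor both decrease in the norm. Whichever of `z j`, `z' j` is smaller may
replace the other in the factor where it occurs, so that each term on the right involves one vector
only. -/
theorem prod_bracket_mul_le {κ ε : ℝ} (hκ : 0 < κ) (h0 : 0 < ε) {k : ℕ} (j : Fin k)
    (z z' : Fin k → F) (h : ∀ i, i ≠ j → z' i = z i) :
    (∏ i, bracket κ (z i)) * ‖z' j‖ₑ ^ (-ε) ≤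
      (∏ i, bracket κ (z i)) * ‖z j‖ₑ ^ (-ε) + (∏ i, bracket κ (z' i)) * ‖z' j‖ₑ ^ (-ε) := by
  rcases le_total ‖z j‖ ‖z' j‖ with hle | hle
  · refine le_add_right (mul_le_mul_right ?_ _)
    rw [ENNReal.rpow_neg, ENNReal.rpow_neg, ENNReal.inv_le_inv]
    refine ENNReal.rpow_le_rpow ?_ h0.le
    exact enorm_le_iff_norm_le.2 hle
  · refine le_add_left (mul_le_mul_left (Finset.prod_le_prod' fun i _ => ?_) _)
    by_cases hij : i = j
    · subst hij; exact bracket_anti hκ hle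
    · rw [h i hij]

/-- The identity with row `j` replaced by `c / c j` turns the functional `c` into a multiple of a
coordinate, without changing volume. -/
theorem exists_shear {k : ℕ} (j : Fin k) (c : Fin k → F) (hc : c j ≠ 0) :
    ∃ S : Matrix (Fin k) (Fin k) F, S.det = 1 ∧ (∀ z i, i ≠ j → (S *ᵥ z) i = z i) ∧
      ∀ z, c ⬝ᵥ z = c j * (S *ᵥ z) j := by
  refine ⟨Matrix.updateRow 1 j ((c j)⁻¹ • c), ?_, ?_, ?_⟩
  · rw [← Matrix.det_transpose, ← Matrix.updateCol_transpose, Matrix.transpose_one,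
      ← Matrix.cramer_apply, Matrix.cramer_one]
    simp [hc]
  · intro z i hij
    rw [Matrix.mulVec, Matrix.updateRow_ne hij]
    exact congrFun (Matrix.one_mulVec z) i
  · intro z
    rw [Matrix.mulVec, Matrix.updateRow_self, smul_dotProduct, smul_eq_mul, ← mul_assoc,
      mul_inv_cancel₀ hc, one_mul]

/-- The product of brackets is not invariant under the shear; `prod_bracket_mul_le` decouples it
from the functional, and the two resulting integrals agree because the shear has determinant one.
This is the factor `2`. -/
theorem lintegral_prod_bracket_dotProduct_le [MeasurableSpace F] [BorelSpace F] (ν : Measure F)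
    [ν.IsAddHaarMeasure] {κ ε : ℝ} (hκ : 0 < κ) (h0 : 0 < ε) {k : ℕ} (j : Fin k)
    (c : Fin k → F) (hc : c j ≠ 0) :
    ∫⁻ z : Fin k → F, (∏ i, bracket κ (z i)) * ‖c ⬝ᵥ z‖ₑ ^ (-ε) ∂(Measure.pi fun _ => ν) ≤
      ‖c j‖ₑ ^ (-ε) * (2 * ∫⁻ z : Fin k → F, (∏ i, bracket κ (z i)) * ‖z j‖ₑ ^ (-ε)
        ∂(Measure.pi fun _ => ν)) := by
  obtain ⟨S, hS, hS1, hS2⟩ := exists_shear j c hc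
  have hΦ : Measurable fun z : Fin k → F => (∏ i, bracket κ (z i)) * ‖z j‖ₑ ^ (-ε) := by
    have := measurable_bracket (F := F) κ
    fun_prop
  have hSi := lintegral_comp_mulVec ν S one_pos (by simpa using hS) hΦ
  rw [Real.one_rpow, ENNReal.ofReal_one, one_mul] at hSi
  have hcj : ‖c j‖ₑ ^ (-ε) ≠ ⊤ := by
    rw [Ne, ENNReal.rpow_eq_top_iff]
    simp [hc]
  calc _ ≤ ∫⁻ z : Fin k → F, ‖c j‖ₑ ^ (-ε) * ((∏ i, bracket κ (z i)) * ‖z j‖ₑ ^ (-ε) +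
          (∏ i, bracket κ ((S *ᵥ z) i)) * ‖(S *ᵥ z) j‖ₑ ^ (-ε)) ∂(Measure.pi fun _ => ν) := by
        refine lintegral_mono fun z => ?_
        dsimp only
        rw [hS2, enorm_mul, ENNReal.mul_rpow_of_ne_top enorm_ne_top enorm_ne_top,
          mul_left_comm]
        exact mul_le_mul_right (prod_bracket_mul_le hκ h0 j z _ (hS1 z)) _
    _ = _ := by
        rw [lintegral_const_mul' _ _ hcj, lintegral_add_left hΦ, hSi, two_mul]

/-- The estimate of the integral over a hyperplane, in the coordinates of a linear chart. -/
theorem exists_lintegral_mulVec_le [MeasurableSpace F] [BorelSpace F] (ν : Measure F)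
    [ν.IsAddHaarMeasure] {κ ε : ℝ} (hκ : 0 < κ) (h0 : 0 < ε) (h1 : ε < 1) (k : ℕ) :
    ∃ C : ENNReal, C ≠ ⊤ ∧ ∀ (T : Matrix (Fin k) (Fin k) F) (t : ℝ) (c : Fin k → F), 0 < t →
      T.det = (t : F) → t ^ 2 + ∑ i, ‖c i‖ ^ 2 = 1 →
      ∫⁻ y, (∏ i, bracket κ ((T *ᵥ y) i)) * min 1 ((‖c ⬝ᵥ (T *ᵥ y)‖ₑ / ENNReal.ofReal t) ^ (-ε))
        ∂(Measure.pi fun _ => ν) ≤ C * ENNReal.ofReal (t ^ (-((Module.finrank ℝ F : ℝ) - ε))) := by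
  set A := ∫⁻ z : Fin k → F, ∏ i, bracket κ (z i) ∂(Measure.pi fun _ => ν) with hA
  set B := fun j : Fin k => ∫⁻ z : Fin k → F, (∏ i, bracket κ (z i)) * ‖z j‖ₑ ^ (-ε)
    ∂(Measure.pi fun _ => ν) with hB
  have hAt : A < ⊤ := lintegral_prod_bracket_lt_top ν hκ k
  have hBt : ∀ j, B j < ⊤ := fun j => lintegral_prod_bracket_mul_lt_top ν hκ h0 h1 j
  -- Pigeonhole: of the `k + 1` squares `t²`, `‖c i‖²` with sum one, some is at least `1/(k+1)`. If
  -- it is `t²`, then `t^ε` is bounded below and the singular factor can be dropped; otherwise some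
  -- `c j` is bounded away from zero.
  set c₀ : ℝ := Real.sqrt (1 / (k + 1)) with hc₀
  have hc₀p : 0 < c₀ := Real.sqrt_pos.2 (by positivity)
  have hc₀2 : c₀ ^ 2 * (k + 1) = 1 := by
    rw [hc₀, Real.sq_sqrt (by positivity)]; field_simp
  set D := ENNReal.ofReal (c₀ ^ (-ε)) with hD
  refine ⟨D * (A + 2 * ∑ j, B j), ?_, ?_⟩
  · refine ENNReal.mul_ne_top ENNReal.ofReal_ne_top (ENNReal.add_ne_top.2 ⟨hAt.ne, ?_⟩)
    exact ENNReal.mul_ne_top (by simp) (ENNReal.sum_lt_top.2 fun j _ => hBt j).ne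
  intro T t c ht hT hsum
  have hm : Measurable fun z : Fin k → F => (∏ i, bracket κ (z i)) *
      min 1 ((‖c ⬝ᵥ z‖ₑ / ENNReal.ofReal t) ^ (-ε)) := by
    have := measurable_bracket (F := F) κ
    have h3 : Measurable fun z : Fin k → F => c ⬝ᵥ z :=
      (continuous_const.dotProduct continuous_id).measurable
    fun_prop
  rw [lintegral_comp_mulVec ν T ht hT hm]
  have hsplit : ENNReal.ofReal (t ^ (-((Module.finrank ℝ F : ℝ) - ε))) =
      ENNReal.ofReal (t ^ (-(Module.finrank ℝ F : ℝ))) * ENNReal.ofReal (t ^ ε) := by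
    rw [← ENNReal.ofReal_mul (by positivity), ← Real.rpow_add ht]
    congr 2; ring
  rw [hsplit, mul_left_comm]
  refine mul_le_mul_right ?_ _
  by_cases hcase : c₀ ≤ t
  · calc _ ≤ A := lintegral_mono fun z => mul_le_of_le_one_right (zero_le) (min_le_left _ _)
      _ ≤ D * ENNReal.ofReal (t ^ ε) * A := by
        refine le_mul_of_one_le_left (zero_le) ?_
        rw [hD, ← ENNReal.ofReal_mul (by positivity), ENNReal.one_le_ofReal,
          Real.rpow_neg hc₀p.le, inv_mul_eq_div, one_le_div (by positivity)]
        exact Real.rpow_le_rpow hc₀p.le hcase h0.le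
      _ ≤ _ := by
        rw [mul_right_comm]
        gcongr
        exact le_self_add
  · obtain ⟨j, hj⟩ : ∃ j, c₀ ≤ ‖c j‖ := by
      by_contra! hcon
      have h4 : ∑ i, ‖c i‖ ^ 2 ≤ ∑ _i : Fin k, c₀ ^ 2 :=
        Finset.sum_le_sum fun i _ => by
          have := (hcon i).le
          gcongr
      have h5 : t ^ 2 < c₀ ^ 2 := by
        have := not_le.1 hcase
        gcongr
      simp at h4
      nlinarith
    have hcj : c j ≠ 0 := norm_pos_iff.1 (hc₀p.trans_le hj)
    have hte : ENNReal.ofReal (t ^ ε) = ENNReal.ofReal t ^ ε := by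
      rw [ENNReal.ofReal_rpow_of_pos ht]
    -- The gain: dividing `c ⬝ᵥ z` by `t` inside the power `-ε` produces `t^ε` outside.
    calc _ ≤ ∫⁻ z : Fin k → F, ENNReal.ofReal (t ^ ε) *
            ((∏ i, bracket κ (z i)) * ‖c ⬝ᵥ z‖ₑ ^ (-ε)) ∂(Measure.pi fun _ => ν) := by
          refine lintegral_mono fun z => ?_
          dsimp only
          rw [mul_left_comm]
          refine mul_le_mul_right ((min_le_right _ _).trans (le_of_eq ?_)) _
          rw [div_eq_mul_inv, ENNReal.mul_rpow_of_ne_top enorm_ne_top (by simp [ht]),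
            ENNReal.inv_rpow, ENNReal.rpow_neg (ENNReal.ofReal t), inv_inv, hte, mul_comm]
      _ = ENNReal.ofReal (t ^ ε) * ∫⁻ z : Fin k → F, ((∏ i, bracket κ (z i)) * ‖c ⬝ᵥ z‖ₑ ^ (-ε))
            ∂(Measure.pi fun _ => ν) := lintegral_const_mul' _ _ ENNReal.ofReal_ne_top
      _ ≤ ENNReal.ofReal (t ^ ε) * (D * (2 * B j)) := by
          refine mul_le_mul_right
            ((lintegral_prod_bracket_dotProduct_le ν hκ h0 j c hcj).trans ?_) _
          refine mul_le_mul_left ?_ _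
          rw [← ofReal_norm, ENNReal.ofReal_rpow_of_pos (hc₀p.trans_le hj)]
          exact ENNReal.ofReal_le_ofReal
            (Real.rpow_le_rpow_of_nonpos hc₀p hj (by linarith))
      _ ≤ _ := by
          rw [mul_comm]
          gcongr
          refine le_add_left ?_
          gcongr
          exact Finset.single_le_sum (f := B) (fun _ _ => zero_le) (Finset.mem_univ j)

end Analysis

/-! ### Leading minors, fundamental weights, and adding a column. -/

section Blocks

variable {F : Type*} [RCLike F] {n l : ℕ}

/-- The top left block of size `l` of a square matrix of size `n ≥ l`. -/
def topLeft (h : l ≤ n) (M : Matrix (Fin n) (Fin n) F) : Matrix (Fin l) (Fin l) F :=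
  M.submatrix (Fin.castLE h) (Fin.castLE h)

theorem sum_castLE {A : Type*} [AddCommMonoid A] (h : l ≤ n) (f : Fin n → A)
    (hf : ∀ k : Fin n, l ≤ k.val → f k = 0) : ∑ k, f k = ∑ i : Fin l, f (Fin.castLE h i) := by
  refine (Fintype.sum_of_injective (Fin.castLE h) (Fin.castLE_injective h) _ _ ?_
    fun _ => rfl).symm
  intro k hk
  refine hf k (not_lt.1 fun hlt => hk ⟨⟨k.val, hlt⟩, ?_⟩)
  ext; simp

theorem topLeft_mul_of_lower (h : l ≤ n) {L : Matrix (Fin n) (Fin n) F}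
    (hL : ∀ i j, i < j → L i j = 0) (M : Matrix (Fin n) (Fin n) F) :
    topLeft h (L * M) = topLeft h L * topLeft h M := by
  ext i j
  simp only [topLeft, Matrix.submatrix_apply, Matrix.mul_apply]
  refine sum_castLE h _ fun k hk => ?_
  rw [hL _ _ (Fin.lt_def.2 (lt_of_lt_of_le i.2 hk)), zero_mul]

theorem topLeft_mul_of_upper (h : l ≤ n) {U : Matrix (Fin n) (Fin n) F}
    (hU : ∀ i j, j < i → U i j = 0) (M : Matrix (Fin n) (Fin n) F) :
    topLeft h (M * U) = topLeft h M * topLeft h U := by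
  ext i j
  simp only [topLeft, Matrix.submatrix_apply, Matrix.mul_apply]
  refine sum_castLE h _ fun k hk => ?_
  rw [hU _ _ (Fin.lt_def.2 (lt_of_lt_of_le j.2 hk)), mul_zero]

theorem IsUpperUnipotent.topLeft (h : l ≤ n) {M : Matrix (Fin n) (Fin n) F}
    (hM : IsUpperUnipotent M) : IsUpperUnipotent (topLeft h M) :=
  ⟨fun _ => hM.1 _, fun _ _ hij => hM.2 _ _ (by simpa using hij)⟩

theorem det_topLeft_of_lower (h : l ≤ n) {L : Matrix (Fin n) (Fin n) F}
    (hL : IsUpperUnipotent Lᵀ) : (topLeft h L).det = 1 := by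
  rw [← Matrix.det_transpose]
  exact (hL.topLeft h).det

theorem det_topLeft_conj (h : l ≤ n) {L : Matrix (Fin n) (Fin n) F}
    (hL : ∀ i j, i < j → L i j = 0) (M : Matrix (Fin n) (Fin n) F) :
    ‖(topLeft h (L * M * Lᴴ)).det‖ = ‖(topLeft h L).det‖ ^ 2 * ‖(topLeft h M).det‖ := by
  have hU : ∀ i j, j < i → Lᴴ i j = 0 := fun i j hij => by
    rw [Matrix.conjTranspose_apply, hL j i hij, star_zero]
  have e : topLeft h Lᴴ = (topLeft h L)ᴴ := rfl
  rw [topLeft_mul_of_upper h hU, topLeft_mul_of_lower h hL, e, Matrix.det_mul, Matrix.det_mul,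
    Matrix.det_conjTranspose, norm_mul, norm_mul, norm_star]
  ring

theorem IsIwasawa.lower_mul_diagonal {g nbar k : Matrix (Fin n) (Fin n) F} {a : Fin n → ℝ}
    (h : IsIwasawa g nbar a k) (i j : Fin n) (hij : i < j) :
    (nbar * Matrix.diagonal fun i => (a i : F)) i j = 0 := by
  have := h.lower.2 j i hij
  rw [Matrix.transpose_apply] at this
  rw [Matrix.mul_diagonal, this, zero_mul]

theorem IsIwasawa.det_topLeft {g nbar k : Matrix (Fin n) (Fin n) F} {a : Fin n → ℝ}
    (h : IsIwasawa g nbar a k) (hl : l ≤ n) :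
    (topLeft hl (nbar * Matrix.diagonal fun i => (a i : F))).det =
      ((∏ i : Fin l, a (Fin.castLE hl i) : ℝ) : F) := by
  rw [topLeft_mul_of_lower hl (L := nbar) fun i j hij => h.lower.2 j i hij, Matrix.det_mul,
    det_topLeft_of_lower hl h.lower, one_mul, topLeft,
    Matrix.submatrix_diagonal _ _ (Fin.castLE_injective hl), Matrix.det_diagonal]
  push_cast
  rfl

theorem IsIwasawa.mul_conjTranspose {g nbar k : Matrix (Fin n) (Fin n) F} {a : Fin n → ℝ}
    (h : IsIwasawa g nbar a k) : g * gᴴ = (nbar * Matrix.diagonal fun i => (a i : F)) * 1 *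
      (nbar * Matrix.diagonal fun i => (a i : F))ᴴ := by
  have hk : k * kᴴ = 1 := Matrix.mem_unitaryGroup_iff.1 h.unitary
  set P := nbar * Matrix.diagonal fun i => (a i : F) with hP
  rw [h.eq, ← hP, Matrix.conjTranspose_mul, Matrix.mul_assoc, ← Matrix.mul_assoc k, hk,
    Matrix.one_mul, Matrix.mul_one]

/-- The unitary factor cancels in `g gᴴ`, and leading minors are multiplicative for a lower
triangular factor on the left and an upper triangular one on the right. -/
theorem IsIwasawa.norm_det_gram {g nbar k : Matrix (Fin n) (Fin n) F} {a : Fin n → ℝ}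
    (h : IsIwasawa g nbar a k) (hl : l ≤ n) :
    ‖(topLeft hl (g * gᴴ)).det‖ = (∏ i : Fin l, a (Fin.castLE hl i)) ^ 2 := by
  have h1 : topLeft hl (1 : Matrix (Fin n) (Fin n) F) = 1 :=
    Matrix.submatrix_one _ (Fin.castLE_injective hl)
  rw [h.mul_conjTranspose, det_topLeft_conj hl h.lower_mul_diagonal, h1, Matrix.det_one, norm_one,
    mul_one, h.det_topLeft hl, RCLike.norm_ofReal, sq_abs]

theorem fundWeight_apply (hl : l ≤ n) (H : Fin n → ℝ) :
    fundWeight n l H = ∑ i : Fin l, H (Fin.castLE hl i) := by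
  rw [fundWeight, LinearMap.sum_apply, Finset.sum_filter,
    sum_castLE hl _ fun k hk => if_neg (not_lt.2 hk)]
  exact Finset.sum_congr rfl fun i _ => if_pos i.2

theorem iwasawaA_pos (g : GL (Fin n) F) (i : Fin n) : 0 < iwasawaA g i := by
  obtain ⟨_, _, h⟩ := iwasawaA_spec g
  exact h.pos i

theorem exp_fundWeight_logA (g : GL (Fin n) F) (hl : l ≤ n) :
    Real.exp (fundWeight n l (logA g)) = ∏ i : Fin l, iwasawaA g (Fin.castLE hl i) := by
  rw [fundWeight_apply hl, Real.exp_sum]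
  exact Finset.prod_congr rfl fun i _ => Real.exp_log (iwasawaA_pos g _)

theorem norm_det_gram_eq_exp (g : GL (Fin n) F) (hl : l ≤ n) :
    ‖(topLeft hl ((g : Matrix (Fin n) (Fin n) F) * (g : Matrix (Fin n) (Fin n) F)ᴴ)).det‖ =
      Real.exp (fundWeight n l (logA g)) ^ 2 := by
  obtain ⟨_, _, h⟩ := iwasawaA_spec g
  rw [h.norm_det_gram hl, exp_fundWeight_logA g hl]

/-- This expresses the weights, defined through a chosen Iwasawa decomposition, by explicit minors.
Continuity and the recursion over columns both rest on it. -/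
theorem fundWeight_logA (g : GL (Fin n) F) (hl : l ≤ n) :
    fundWeight n l (logA g) = 1 / 2 * Real.log
      ‖(topLeft hl ((g : Matrix (Fin n) (Fin n) F) * (g : Matrix (Fin n) (Fin n) F)ᴴ)).det‖ := by
  rw [norm_det_gram_eq_exp, Real.log_pow, Real.log_exp]
  push_cast
  ring

theorem fundWeight_self_logA (g : GL (Fin n) F) (hg : (g : Matrix (Fin n) (Fin n) F).det = 1) :
    fundWeight n n (logA g) = 0 := by
  have h : topLeft le_rfl ((g : Matrix (Fin n) (Fin n) F) * (g : Matrix (Fin n) (Fin n) F)ᴴ) =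
      (g : Matrix (Fin n) (Fin n) F) * (g : Matrix (Fin n) (Fin n) F)ᴴ := by
    ext i j; simp [topLeft]
  rw [fundWeight_logA g le_rfl, h, Matrix.det_mul, Matrix.det_conjTranspose, hg]
  simp

theorem fundWeight_zero (H : Fin n → ℝ) : fundWeight n 0 H = 0 := by
  rw [fundWeight_apply (Nat.zero_le n)]; simp

/-- The matrix `(A x; 0 1)`. -/
def border (A : Matrix (Fin n) (Fin n) F) (x : Fin n → F) :
    Matrix (Fin (n + 1)) (Fin (n + 1)) F :=
  Matrix.of (Fin.snoc (α := fun _ => Fin (n + 1) → F)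
    (fun i => Fin.snoc (α := fun _ => F) (A i) (x i)) (Fin.snoc (α := fun _ => F) 0 1))

@[simp] theorem border_castSucc_castSucc (A : Matrix (Fin n) (Fin n) F) (x : Fin n → F)
    (i j : Fin n) : border A x i.castSucc j.castSucc = A i j := by simp [border]

@[simp] theorem border_castSucc_last (A : Matrix (Fin n) (Fin n) F) (x : Fin n → F)
    (i : Fin n) : border A x i.castSucc (Fin.last n) = x i := by simp [border]

@[simp] theorem border_last_castSucc (A : Matrix (Fin n) (Fin n) F) (x : Fin n → F)
    (j : Fin n) : border A x (Fin.last n) j.castSucc = 0 := by simp [border]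

@[simp] theorem border_last_last (A : Matrix (Fin n) (Fin n) F) (x : Fin n → F) :
    border A x (Fin.last n) (Fin.last n) = 1 := by simp [border]

theorem border_mul (A B : Matrix (Fin n) (Fin n) F) (x y : Fin n → F) :
    border A x * border B y = border (A * B) (A *ᵥ y + x) := by
  ext i j
  rw [Matrix.mul_apply, Fin.sum_univ_castSucc]
  refine Fin.lastCases ?_ (fun i => ?_) i <;> refine Fin.lastCases ?_ (fun j => ?_) j <;>
    simp [Matrix.mul_apply, Matrix.mulVec, dotProduct]

theorem border_one_zero : border (1 : Matrix (Fin n) (Fin n) F) 0 = 1 := by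
  ext i j
  refine Fin.lastCases ?_ (fun i => ?_) i <;> refine Fin.lastCases ?_ (fun j => ?_) j
  · simp
  · rw [border_last_castSucc, Matrix.one_apply_ne (Fin.castSucc_lt_last j).ne']
  · rw [border_castSucc_last, Matrix.one_apply_ne (Fin.castSucc_lt_last i).ne]; rfl
  · rw [border_castSucc_castSucc, Matrix.one_apply, Matrix.one_apply]
    simp

theorem isUpperUnipotent_border {A : Matrix (Fin n) (Fin n) F} {x : Fin n → F} :
    IsUpperUnipotent (border A x) ↔ IsUpperUnipotent A := by
  refine ⟨fun h => ⟨fun i => ?_, fun i j hij => ?_⟩, fun h => ⟨fun i => ?_, fun i j => ?_⟩⟩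
  · simpa using h.1 i.castSucc
  · simpa using h.2 i.castSucc j.castSucc (by simpa using hij)
  · refine Fin.lastCases ?_ (fun i => ?_) i
    · simp
    · simpa using h.1 i
  · refine Fin.lastCases ?_ (fun i => ?_) i <;> refine Fin.lastCases ?_ (fun j => ?_) j
    · simp
    · simp
    · intro hij; exact absurd hij (not_lt.2 (Fin.le_last _))
    · intro hij; simpa using h.2 i j (by simpa using hij)

theorem IsUpperUnipotent.eq_border {M : Matrix (Fin (n + 1)) (Fin (n + 1)) F}
    (h : IsUpperUnipotent M) :
    M = border (M.submatrix Fin.castSucc Fin.castSucc) fun i => M i.castSucc (Fin.last n) := by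
  ext i j
  refine Fin.lastCases ?_ (fun i => ?_) i <;> refine Fin.lastCases ?_ (fun j => ?_) j
  · simp [h.1]
  · simp [h.2 _ _ (Fin.castSucc_lt_last j)]
  · simp
  · simp

theorem topLeft_gram_border (A : Matrix (Fin n) (Fin n) F) (x : Fin n → F) (hl : l ≤ n) :
    topLeft (hl.trans n.le_succ) (border A x * (border A x)ᴴ) =
      topLeft hl (A * Aᴴ + vecMulVec x (star x)) := by
  have e : ∀ i : Fin l, Fin.castLE (hl.trans n.le_succ) i = (Fin.castLE hl i).castSucc :=
    fun i => rfl
  ext i j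
  simp only [topLeft, Matrix.submatrix_apply, e]
  rw [Matrix.mul_apply, Fin.sum_univ_castSucc]
  simp only [Matrix.conjTranspose_apply, border_castSucc_castSucc, border_castSucc_last,
    Matrix.add_apply, Matrix.mul_apply, vecMulVec_apply, Pi.star_apply]

/-- The block is a rank one perturbation of the identity, so the matrix determinant lemma applies.
-/
theorem det_topLeft_one_add (z : Fin n → F) (hl : l ≤ n) :
    ‖(topLeft hl (1 + vecMulVec z (star z))).det‖ =
      1 + ∑ i : Fin l, ‖z (Fin.castLE hl i)‖ ^ 2 := by
  have e : topLeft hl (1 + vecMulVec z (star z)) =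
      1 + replicateCol Unit (fun i => z (Fin.castLE hl i)) *
        replicateRow Unit (star fun i => z (Fin.castLE hl i)) := by
    ext i j
    simp [topLeft, Matrix.one_apply, vecMulVec_apply, Matrix.mul_apply]
  have h : (1 : F) + (star fun i => z (Fin.castLE hl i)) ⬝ᵥ (fun i => z (Fin.castLE hl i)) =
      ((1 + ∑ i : Fin l, ‖z (Fin.castLE hl i)‖ ^ 2 : ℝ) : F) := by
    simp [dotProduct, RCLike.conj_mul]
  rw [e, det_one_add_replicateCol_mul_replicateRow, h, RCLike.norm_ofReal, abs_of_nonneg]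
  positivity

/-- The effect on the fundamental weights of adding a column. -/
theorem fundWeight_logA_border {g : GL (Fin n) F} {nbar k : Matrix (Fin n) (Fin n) F}
    (h : IsIwasawa (g : Matrix (Fin n) (Fin n) F) nbar (iwasawaA g) k) (y : Fin n → F)
    {G : GL (Fin (n + 1)) F} (hG : (G : Matrix (Fin (n + 1)) (Fin (n + 1)) F) =
      border (g : Matrix (Fin n) (Fin n) F) ((g : Matrix (Fin n) (Fin n) F) *ᵥ y)) (hl : l ≤ n) :
    fundWeight (n + 1) l (logA G) = fundWeight n l (logA g) +
      1 / 2 * Real.log (1 + ∑ i : Fin l, ‖(k *ᵥ y) (Fin.castLE hl i)‖ ^ 2) := by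
  set P := nbar * Matrix.diagonal fun i => (iwasawaA g i : F) with hP
  -- With `z = k y` the bordered Gram matrix becomes `P (1 + z zᴴ) Pᴴ`, whose leading minors factor
  -- since `P` is lower triangular.
  have hg : (g : Matrix (Fin n) (Fin n) F) *ᵥ y = P *ᵥ (k *ᵥ y) := by
    rw [Matrix.mulVec_mulVec, hP, ← h.eq]
  have e : (g : Matrix (Fin n) (Fin n) F) * (g : Matrix (Fin n) (Fin n) F)ᴴ +
      vecMulVec ((g : Matrix (Fin n) (Fin n) F) *ᵥ y)
        (star ((g : Matrix (Fin n) (Fin n) F) *ᵥ y)) =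
      P * (1 + vecMulVec (k *ᵥ y) (star (k *ᵥ y))) * Pᴴ := by
    rw [hg, h.mul_conjTranspose, ← hP, Matrix.mul_add, Matrix.add_mul, Matrix.mul_vecMulVec,
      Matrix.vecMulVec_mul, Matrix.star_mulVec]
  have hpos : 0 < ∏ i : Fin l, iwasawaA g (Fin.castLE hl i) :=
    Finset.prod_pos fun i _ => iwasawaA_pos g _
  rw [fundWeight_logA G (hl.trans n.le_succ), hG, topLeft_gram_border, e,
    det_topLeft_conj hl h.lower_mul_diagonal, det_topLeft_one_add, h.det_topLeft hl,
    RCLike.norm_ofReal, sq_abs, ← exp_fundWeight_logA g hl,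
    Real.log_mul (by positivity) (by positivity), Real.log_pow, Real.log_exp]
  · push_cast
    ring
  · exact hl

end Blocks

/-! ### The unitary factor of a unipotent matrix and the hyperplane it determines. -/

section Hyperplane

variable {F : Type*} [RCLike F] {m : ℕ}

theorem exp_neg_fundWeight_logA (g : GL (Fin (m + 1)) F)
    (hg : (g : Matrix (Fin (m + 1)) (Fin (m + 1)) F).det = 1) :
    Real.exp (-fundWeight (m + 1) m (logA g)) = iwasawaA g (Fin.last m) := by
  have h := fundWeight_self_logA g hg
  rw [fundWeight_apply le_rfl, Fin.sum_univ_castSucc] at h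
  rw [fundWeight_apply m.le_succ, ← Real.exp_log (iwasawaA_pos g (Fin.last m))]
  congr 1
  exact (eq_neg_of_add_eq_zero_right h).symm

/-- The last row of `g` is the last basis vector, so it suffices to compare the corner entries of `g
kᴴ = nbar a`. -/
theorem IsIwasawa.last_last {g nbar k : Matrix (Fin (m + 1)) (Fin (m + 1)) F}
    {a : Fin (m + 1) → ℝ} (h : IsIwasawa g nbar a k) (hg : IsUpperUnipotent g) :
    k (Fin.last m) (Fin.last m) = (a (Fin.last m) : F) := by
  have hk : k * kᴴ = 1 := Matrix.mem_unitaryGroup_iff.1 h.unitary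
  have e : g * kᴴ = nbar * Matrix.diagonal fun i => (a i : F) := by
    rw [h.eq, Matrix.mul_assoc, hk, Matrix.mul_one]
  have e1 := congrFun (congrFun e (Fin.last m)) (Fin.last m)
  have h1 : nbar (Fin.last m) (Fin.last m) = 1 := h.lower.1 _
  rw [Matrix.mul_diagonal, h1, one_mul, Matrix.mul_apply, Finset.sum_eq_single (Fin.last m), hg.1,
    one_mul, Matrix.conjTranspose_apply] at e1
  · have := congrArg star e1
    rw [star_star] at this
    rw [this]; simp
  · intro j _ hj
    rw [hg.2 _ _ (Fin.lt_last_iff_ne_last.2 hj), zero_mul]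
  · simp

/-- The leading minor of `g` is one, and it is the product of the first `m` entries of `a` with the
minor of `k`; the product of all entries of `a` is one. -/
theorem IsIwasawa.det_topLeft_unitary {g nbar k : Matrix (Fin (m + 1)) (Fin (m + 1)) F}
    {a : Fin (m + 1) → ℝ} (h : IsIwasawa g nbar a k) (hg : IsUpperUnipotent g) :
    (topLeft m.le_succ k).det = (a (Fin.last m) : F) := by
  have e : (topLeft m.le_succ g).det = 1 := (hg.topLeft m.le_succ).det
  rw [h.eq, topLeft_mul_of_lower _ h.lower_mul_diagonal, Matrix.det_mul, h.det_topLeft] at e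
  have hd := (h.det_eq_one hg.det).2.1
  rw [Matrix.det_diagonal, Fin.prod_univ_castSucc] at hd
  have hne : ((∏ i : Fin m, a (Fin.castLE m.le_succ i) : ℝ) : F) ≠ 0 :=
    left_ne_zero_of_mul_eq_one e
  refine mul_left_cancel₀ hne (e.trans ?_)
  rw [← hd]
  push_cast
  rfl

theorem IsIwasawa.sum_norm_sq {g nbar k : Matrix (Fin (m + 1)) (Fin (m + 1)) F}
    {a : Fin (m + 1) → ℝ} (h : IsIwasawa g nbar a k) (hg : IsUpperUnipotent g) :
    a (Fin.last m) ^ 2 + ∑ i : Fin m, ‖-star (k i.castSucc (Fin.last m))‖ ^ 2 = 1 := by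
  have hk : kᴴ * k = 1 := Matrix.mem_unitaryGroup_iff'.1 h.unitary
  have e := congrFun (congrFun hk (Fin.last m)) (Fin.last m)
  rw [Matrix.mul_apply, Fin.sum_univ_castSucc, Matrix.one_apply_eq] at e
  simp only [Matrix.conjTranspose_apply, h.last_last hg, RCLike.star_def, RCLike.conj_mul,
    RCLike.norm_ofReal] at e
  have e' : (∑ i : Fin m, ‖k i.castSucc (Fin.last m)‖ ^ 2) + |a (Fin.last m)| ^ 2 = 1 := by
    exact_mod_cast e
  rw [sq_abs] at e'
  simp only [norm_neg, norm_star]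
  linarith

theorem mulVec_snoc_castSucc (k : Matrix (Fin (m + 1)) (Fin (m + 1)) F) (y : Fin m → F)
    (i : Fin m) : (k *ᵥ (Fin.snoc y 0 : Fin (m + 1) → F)) i.castSucc =
      (topLeft m.le_succ k *ᵥ y) i := by
  simp only [Matrix.mulVec, dotProduct, Fin.sum_univ_castSucc]
  simp [topLeft]
  rfl

/-- Since `k` is unitary and `(y,0)` has last coordinate zero, `k(y,0)` is orthogonal to the last
column of `k`, whose last entry is `a (Fin.last m)`. Solve this relation for the last coordinate. -/
theorem IsIwasawa.norm_mulVec_last {g nbar k : Matrix (Fin (m + 1)) (Fin (m + 1)) F}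
    {a : Fin (m + 1) → ℝ} (h : IsIwasawa g nbar a k) (hg : IsUpperUnipotent g) (y : Fin m → F) :
    ‖(k *ᵥ (Fin.snoc y 0 : Fin (m + 1) → F)) (Fin.last m)‖ =
      ‖(fun i : Fin m => -star (k i.castSucc (Fin.last m))) ⬝ᵥ (topLeft m.le_succ k *ᵥ y)‖ /
        a (Fin.last m) := by
  have hk : kᴴ * k = 1 := Matrix.mem_unitaryGroup_iff'.1 h.unitary
  set Y : Fin (m + 1) → F := Fin.snoc y 0 with hY
  have e : (kᴴ *ᵥ (k *ᵥ Y)) (Fin.last m) = 0 := by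
    rw [Matrix.mulVec_mulVec, hk, Matrix.one_mulVec, hY, Fin.snoc_last]
  rw [Matrix.mulVec, dotProduct, Fin.sum_univ_castSucc] at e
  simp only [Matrix.conjTranspose_apply, h.last_last hg, RCLike.star_def, RCLike.conj_ofReal] at e
  have e2 : (a (Fin.last m) : F) * (k *ᵥ Y) (Fin.last m) =
      (fun i : Fin m => -star (k i.castSucc (Fin.last m))) ⬝ᵥ (topLeft m.le_succ k *ᵥ y) := by
    rw [dotProduct]
    simp only [← mulVec_snoc_castSucc, ← hY, neg_mul, Finset.sum_neg_distrib, RCLike.star_def]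
    exact eq_neg_of_add_eq_zero_right e
  have hp := h.pos (Fin.last m)
  rw [← e2, norm_mul, RCLike.norm_ofReal, abs_of_pos hp]
  field_simp

end Hyperplane

/-! ### The commutator subgroup as the unipotent matrices with zero superdiagonal. -/

section Commutators

open scoped commutatorElement

variable {F : Type*} [RCLike F] {n k : ℕ}

theorem det_border (A : Matrix (Fin n) (Fin n) F) (x : Fin n → F) :
    (border A x).det = A.det := by
  rw [Matrix.det_succ_row _ (Fin.last n), Finset.sum_eq_single (Fin.last n)]
  · have : (border A x).submatrix (Fin.last n).succAbove (Fin.last n).succAbove = A := by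
      ext i j
      simp [Fin.succAbove_last]
    rw [this]
    simp [← two_mul, pow_mul]
  · intro j _ hj
    obtain ⟨j, rfl⟩ := Fin.exists_castSucc_eq.2 hj
    simp
  · simp

/-- The embedding of `SL(n, F)` into `SL(n + 1, F)` as the top left corner. -/
def cornerHom (n : ℕ) (F : Type*) [RCLike F] :
    SpecialLinearGroup (Fin n) F →* SpecialLinearGroup (Fin (n + 1)) F where
  toFun A := ⟨border A.1 0, by rw [det_border, A.2]⟩
  map_one' := Subtype.ext border_one_zero
  map_mul' A B := Subtype.ext (by
    change border (A.1 * B.1) 0 = border A.1 0 * border B.1 0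
    rw [border_mul, Matrix.mulVec_zero, add_zero])

/-- The last column of an element of `SL(n + 1, F)`, equal to the identity elsewhere. -/
def columnSL (x : Fin n → F) : SpecialLinearGroup (Fin (n + 1)) F :=
  ⟨border 1 x, by rw [det_border, Matrix.det_one]⟩

theorem columnSL_neg (x : Fin n → F) : columnSL (-x) = (columnSL x)⁻¹ := by
  refine eq_inv_of_mul_eq_one_left (Subtype.ext ?_)
  change border 1 (-x) * border 1 x = 1
  rw [border_mul, Matrix.one_mulVec, Matrix.one_mul, add_neg_cancel, border_one_zero]

/-- Upper triangular matrices with ones on the diagonal and zeros right above it. -/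
def IsStrictUnipotent (M : Matrix (Fin n) (Fin n) F) : Prop :=
  IsUpperUnipotent M ∧ ∀ i j : Fin n, i.val + 1 = j.val → M i j = 0

/-- The superdiagonal is thus a homomorphism from `N` to an abelian group and must vanish on
commutators. -/
theorem IsUpperUnipotent.mul_superdiag {M M' : Matrix (Fin n) (Fin n) F}
    (h : IsUpperUnipotent M) (h' : IsUpperUnipotent M') {i j : Fin n} (hij : i.val + 1 = j.val) :
    (M * M') i j = M i j + M' i j := by
  have hne : i ≠ j := by rintro rfl; omega
  rw [Matrix.mul_apply, Fintype.sum_eq_add i j hne, h.1, h'.1, one_mul, mul_one, add_comm]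
  rintro l ⟨hi, hj⟩
  rcases lt_or_gt_of_ne hi with hl | hl
  · rw [h.2 _ _ hl, zero_mul]
  · rw [h'.2, mul_zero]
    rw [Fin.lt_def] at hl ⊢
    have : l.val ≠ j.val := fun e => hj (Fin.ext e)
    omega

theorem mem_upperUnipotentSL {v : SpecialLinearGroup (Fin n) F} :
    v ∈ upperUnipotentSL n F ↔ IsUpperUnipotent v.1 := Iff.rfl

/-- The matrices of `IsStrictUnipotent`, as a subgroup of `SL(n, F)`. -/
def strictUnipotentSL (n : ℕ) (F : Type*) [RCLike F] :
    Subgroup (SpecialLinearGroup (Fin n) F) where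
  carrier := {v | IsStrictUnipotent v.1}
  one_mem' := ⟨IsUpperUnipotent.one, fun i j hij =>
    Matrix.one_apply_ne (by rintro rfl; omega)⟩
  mul_mem' := by
    intro a b ha hb
    refine ⟨ha.1.mul hb.1, fun i j hij => ?_⟩
    change (a.1 * b.1) i j = 0
    rw [ha.1.mul_superdiag hb.1 hij, ha.2 i j hij, hb.2 i j hij, add_zero]
  inv_mem' := by
    intro a ha
    have h1 : IsUpperUnipotent (a⁻¹).1 :=
      mem_upperUnipotentSL.1 (inv_mem (mem_upperUnipotentSL.2 ha.1))
    refine ⟨h1, fun i j hij => ?_⟩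
    have h2 := ha.1.mul_superdiag h1 hij
    have h3 : a.1 * (a⁻¹).1 = 1 := congrArg Subtype.val (mul_inv_cancel a)
    rw [h3, ha.2 i j hij, zero_add, Matrix.one_apply_ne (by rintro rfl; omega)] at h2
    exact h2.symm

theorem commSL_le : commSL n F ≤ strictUnipotentSL n F := by
  rw [Subgroup.commutator_le]
  intro a ha b hb
  have hm := fun {x y : SpecialLinearGroup (Fin n) F} (hx : x ∈ upperUnipotentSL n F)
    (hy : y ∈ upperUnipotentSL n F) {i j : Fin n} (hij : i.val + 1 = j.val) =>
      IsUpperUnipotent.mul_superdiag (mem_upperUnipotentSL.1 hx) (mem_upperUnipotentSL.1 hy) hij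
  have hba := mul_mem hb ha
  refine ⟨mem_upperUnipotentSL.1
    (mul_mem (mul_mem (mul_mem ha hb) (inv_mem ha)) (inv_mem hb)), fun i j hij => ?_⟩
  have e : ⁅a, b⁆ * (b * a) = a * b := by
    rw [commutatorElement_def]; group
  have hc : ⁅a, b⁆ ∈ upperUnipotentSL n F :=
    mul_mem (mul_mem (mul_mem ha hb) (inv_mem ha)) (inv_mem hb)
  have h1 := hm hc hba hij
  have h2 : (⁅a, b⁆.1 * (b * a).1) i j = (a * b).1 i j :=
    congrFun (congrFun (congrArg Subtype.val e) i) j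
  have h3 : (a * b).1 i j = a.1 i j + b.1 i j := hm ha hb hij
  have h4 : (b * a).1 i j = b.1 i j + a.1 i j := hm hb ha hij
  rw [h2, h3, h4, add_comm (b.1 i j)] at h1
  exact left_eq_add.1 (h1.trans (add_comm _ _))

theorem isStrictUnipotent_border {A : Matrix (Fin (k + 1)) (Fin (k + 1)) F}
    {x : Fin (k + 1) → F} :
    IsStrictUnipotent (border A x) ↔ IsStrictUnipotent A ∧ x (Fin.last k) = 0 := by
  unfold IsStrictUnipotent
  rw [isUpperUnipotent_border, and_assoc]
  refine and_congr_right fun _ => ⟨fun h => ⟨fun i j hij => ?_, ?_⟩, fun h i j => ?_⟩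
  · simpa using h i.castSucc j.castSucc hij
  · simpa using h (Fin.last k).castSucc (Fin.last (k + 1)) (by simp)
  · refine Fin.lastCases ?_ (fun i => ?_) i <;> refine Fin.lastCases ?_ (fun j => ?_) j
    · intro hij; simp at hij
    · intro hij
      have := j.2
      simp at hij
      omega
    · intro hij
      have : i = Fin.last k := Fin.ext (by simpa using hij)
      rw [this, border_castSucc_last, h.2]
    · intro hij
      rw [border_castSucc_castSucc, h.1 i j (by simpa using hij)]

/-- The unipotent matrix with ones on and right above the diagonal. -/
def jordanMatrix (k : ℕ) (F : Type*) [RCLike F] : Matrix (Fin (k + 1)) (Fin (k + 1)) F :=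
  Matrix.of fun i j => (if i = j then 1 else 0) + if i.val + 1 = j.val then 1 else 0

theorem isUpperUnipotent_jordanMatrix : IsUpperUnipotent (jordanMatrix k F) := by
  refine ⟨fun i => by simp [jordanMatrix], fun i j hij => ?_⟩
  have h1 : i ≠ j := hij.ne'
  have h2 : i.val + 1 ≠ j.val := by rw [Fin.lt_def] at hij; omega
  simp [jordanMatrix, h1, h2]

/-- The Jordan matrix minus the identity shifts coordinates up by one place; shifting `x` down gives
a preimage, as its last entry is zero. -/
theorem jordanMatrix_mulVec (x : Fin (k + 1) → F) (hx : x (Fin.last k) = 0) :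
    jordanMatrix k F *ᵥ (Fin.cons 0 fun i : Fin k => x i.castSucc) -
      (Fin.cons 0 fun i : Fin k => x i.castSucc) = x := by
  set w : Fin (k + 1) → F := Fin.cons 0 fun i : Fin k => x i.castSucc with hw
  ext i
  rw [Pi.sub_apply, Matrix.mulVec, dotProduct]
  simp only [jordanMatrix, Matrix.of_apply, add_mul, ite_mul, one_mul, zero_mul,
    Finset.sum_add_distrib, Finset.sum_ite_eq, Finset.mem_univ, if_true, add_sub_cancel_left]
  refine Fin.lastCases ?_ (fun i => ?_) i
  · rw [hx]
    refine Finset.sum_eq_zero fun j _ => if_neg ?_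
    have := j.2
    simp
    omega
  · rw [Finset.sum_eq_single i.succ]
    · simp [hw]
    · intro j _ hj
      refine if_neg fun h => hj (Fin.ext ?_)
      simpa using h.symm
    · simp

theorem border_commutator {U U' : Matrix (Fin n) (Fin n) F} (h : U * U' = 1) (w : Fin n → F) :
    border U 0 * border 1 w * border U' 0 * border 1 (-w) = border 1 (U *ᵥ w - w) := by
  simp only [border_mul, Matrix.mul_one, h, Matrix.mulVec_zero, zero_add, add_zero,
    Matrix.one_mulVec, neg_add_eq_sub]

/-- Such a column is a single commutator: commuting a corner matrix `U` with a column `w` gives the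
column `U w - w`. -/
theorem columnSL_mem (x : Fin (k + 1) → F) (hx : x (Fin.last k) = 0) :
    columnSL x ∈ commSL (k + 2) F := by
  set w : Fin (k + 1) → F := Fin.cons 0 fun i : Fin k => x i.castSucc with hw
  set u : SpecialLinearGroup (Fin (k + 1)) F :=
    ⟨jordanMatrix k F, isUpperUnipotent_jordanMatrix.det⟩ with hu
  have e : columnSL x = ⁅cornerHom _ F u, columnSL w⁆ := by
    rw [commutatorElement_def, ← map_inv, ← columnSL_neg]
    refine Subtype.ext ?_
    change border 1 x = border u.1 0 * border 1 w * border (u⁻¹).1 0 * border 1 (-w)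
    rw [border_commutator (congrArg Subtype.val (mul_inv_cancel u))]
    congr 1
    exact (jordanMatrix_mulVec x hx).symm
  rw [e]
  exact Subgroup.commutator_mem_commutator
    (mem_upperUnipotentSL.2 (isUpperUnipotent_border.2 isUpperUnipotent_jordanMatrix))
    (show columnSL w ∈ upperUnipotentSL _ F from isUpperUnipotent_border.2 IsUpperUnipotent.one)

theorem cornerHom_mem {v : SpecialLinearGroup (Fin n) F} (hv : v ∈ commSL n F) :
    cornerHom n F v ∈ commSL (n + 1) F := by
  have h1 : (upperUnipotentSL n F).map (cornerHom n F) ≤ upperUnipotentSL (n + 1) F := by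
    rintro _ ⟨a, ha, rfl⟩
    exact mem_upperUnipotentSL.2 (isUpperUnipotent_border.2 ha)
  have h2 : (commSL n F).map (cornerHom n F) ≤ commSL (n + 1) F := by
    rw [commSL, Subgroup.map_commutator]
    exact Subgroup.commutator_mono h1 h1
  exact h2 ⟨v, hv, rfl⟩

/-- Induction on the size: split off the last column, a commutator, and apply the induction
hypothesis to the corner. -/
theorem mem_commSL_of_isStrictUnipotent {v : SpecialLinearGroup (Fin n) F}
    (h : IsStrictUnipotent v.1) : v ∈ commSL n F := by
  induction n with
  | zero =>
    have : v = 1 := Subtype.ext (Subsingleton.elim _ _)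
    rw [this]; exact one_mem _
  | succ n ih =>
    cases n with
    | zero =>
      have : v = 1 := by
        refine Subtype.ext ?_
        ext i j
        rw [Fin.fin_one_eq_zero i, Fin.fin_one_eq_zero j]
        exact h.1.1 0
      rw [this]; exact one_mem _
    | succ k =>
      have hb := h.1.eq_border
      set A := v.1.submatrix Fin.castSucc Fin.castSucc with hA
      set x := fun i : Fin (k + 1) => v.1 i.castSucc (Fin.last (k + 1)) with hx
      rw [hb, isStrictUnipotent_border] at h
      have hv : v = columnSL x * cornerHom _ F ⟨A, h.1.1.det⟩ := by
        refine Subtype.ext (hb.trans ?_)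
        change border A x = border 1 x * border A 0
        rw [border_mul, Matrix.one_mul, Matrix.mulVec_zero, zero_add]
      rw [hv]
      exact mul_mem (columnSL_mem x h.2) (cornerHom_mem (ih h.1))

theorem mem_commSL {v : SpecialLinearGroup (Fin n) F} :
    v ∈ commSL n F ↔ IsStrictUnipotent v.1 :=
  ⟨fun h => commSL_le h, mem_commSL_of_isStrictUnipotent⟩

theorem commSL_isUpperUnipotent (v : commSL n F) : IsUpperUnipotent v.1.1 :=
  (mem_commSL.1 v.2).1

end Commutators

/-! ### Haar measure on the commutator subgroup in column coordinates. -/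

section Haar

variable {F : Type*} [RCLike F] {n k : ℕ}

theorem isClosedEmbedding_commSL :
    Topology.IsClosedEmbedding fun v : commSL n F => (v.1.1 : Matrix (Fin n) (Fin n) F) := by
  refine ⟨Topology.IsEmbedding.subtypeVal.comp Topology.IsEmbedding.subtypeVal, ?_⟩
  have : Set.range (fun v : commSL n F => (v.1.1 : Matrix (Fin n) (Fin n) F)) =
      {M | IsStrictUnipotent M} := by
    ext M
    exact ⟨by rintro ⟨v, rfl⟩; exact mem_commSL.1 v.2,
      fun h => ⟨⟨⟨M, h.1.det⟩, mem_commSL.2 h⟩, rfl⟩⟩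
  rw [this]
  simp only [IsStrictUnipotent, IsUpperUnipotent, Set.ofPred_and, Set.ofPred_forall]
  have hc : ∀ i j, Continuous fun M : Matrix (Fin n) (Fin n) F => M i j := fun i j =>
    continuous_id.matrix_elem i j
  refine ((isClosed_iInter fun i => ?_).inter ?_).inter ?_
  · exact isClosed_eq (hc _ _) continuous_const
  · exact isClosed_iInter fun i => isClosed_iInter fun j => isClosed_iInter fun _ =>
      isClosed_eq (hc _ _) continuous_const
  · exact isClosed_iInter fun i => isClosed_iInter fun j => isClosed_iInter fun _ =>
      isClosed_eq (hc _ _) continuous_const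

instance : SecondCountableTopology (Matrix (Fin n) (Fin n) F) :=
  inferInstanceAs (SecondCountableTopology (Fin n → Fin n → F))

instance : LocallyCompactSpace (Matrix (Fin n) (Fin n) F) :=
  inferInstanceAs (LocallyCompactSpace (Fin n → Fin n → F))

instance : SecondCountableTopology (commSL n F) :=
  isClosedEmbedding_commSL.isEmbedding.secondCountableTopology

instance : LocallyCompactSpace (commSL n F) :=
  isClosedEmbedding_commSL.locallyCompactSpace

theorem IsUpperUnipotent.mulVec_last {M : Matrix (Fin (k + 1)) (Fin (k + 1)) F}
    (h : IsUpperUnipotent M) (x : Fin (k + 1) → F) :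
    (M *ᵥ x) (Fin.last k) = x (Fin.last k) := by
  rw [Matrix.mulVec, dotProduct, Finset.sum_eq_single (Fin.last k), h.1, one_mul]
  · intro j _ hj
    rw [h.2 _ _ (Fin.lt_last_iff_ne_last.2 hj), zero_mul]
  · simp

/-- Appending a zero coordinate. -/
def snocZero (y : Fin k → F) : Fin (k + 1) → F := Fin.snoc y 0

@[simp] theorem snocZero_castSucc (y : Fin k → F) (i : Fin k) : snocZero y i.castSucc = y i := by
  simp [snocZero]

@[simp] theorem snocZero_last (y : Fin k → F) : snocZero y (Fin.last k) = 0 := by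
  simp [snocZero]

theorem snocZero_eq {x : Fin (k + 1) → F} (hx : x (Fin.last k) = 0) :
    snocZero (fun i => x i.castSucc) = x := by
  ext i
  refine Fin.lastCases ?_ (fun i => ?_) i
  · simp [hx]
  · simp

theorem snocZero_add (y y' : Fin k → F) : snocZero (y + y') = snocZero y + snocZero y' := by
  ext i
  refine Fin.lastCases ?_ (fun i => ?_) i <;> simp

theorem continuous_snocZero : Continuous (snocZero : (Fin k → F) → Fin (k + 1) → F) := by
  refine continuous_pi fun i => ?_
  refine Fin.lastCases ?_ (fun i => ?_) i
  · simpa using continuous_const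
  · simpa using continuous_apply i

/-- The top left corner of an element of `[N, N]`. -/
def corner (v : commSL (k + 2) F) : commSL (k + 1) F :=
  ⟨⟨v.1.1.submatrix Fin.castSucc Fin.castSucc,
    (isUpperUnipotent_border.1 ((commSL_isUpperUnipotent v).eq_border ▸
      commSL_isUpperUnipotent v)).det⟩,
    mem_commSL.2 (isStrictUnipotent_border.1 ((commSL_isUpperUnipotent v).eq_border ▸
      mem_commSL.1 v.2)).1⟩

theorem continuous_commSL_val :
    Continuous fun v : commSL n F => (v.1.1 : Matrix (Fin n) (Fin n) F) :=
  isClosedEmbedding_commSL.continuous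

theorem commSL_inv_mul_val (v : commSL n F) : (v⁻¹).1.1 * v.1.1 = 1 :=
  congrArg (fun w : commSL n F => w.1.1) (inv_mul_cancel v)

theorem commSL_mul_inv_val (v : commSL n F) : v.1.1 * (v⁻¹).1.1 = 1 :=
  congrArg (fun w : commSL n F => w.1.1) (mul_inv_cancel v)

/-- The parametrization of `[N, N]` in `SL(k + 2, F)` by its corner and its last column. -/
def columnChart (k : ℕ) (F : Type*) [RCLike F] :
    (commSL (k + 1) F × (Fin k → F)) ≃ₜ commSL (k + 2) F where
  -- Writing the column as the corner times `(y,0)` makes the weights depend on `y` only through the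
  -- unitary part of the corner applied to `(y,0)`. The appended zero is the superdiagonal entry.
  toFun p := ⟨⟨border p.1.1.1 (p.1.1.1 *ᵥ snocZero p.2), by rw [det_border, p.1.1.2]⟩,
    mem_commSL.2 (isStrictUnipotent_border.2 ⟨mem_commSL.1 p.1.2, by
      rw [(commSL_isUpperUnipotent p.1).mulVec_last, snocZero_last]⟩)⟩
  invFun v := (corner v,
    fun i => (((corner v)⁻¹).1.1 *ᵥ
      fun j : Fin (k + 1) => v.1.1 j.castSucc (Fin.last _)) i.castSucc)
  left_inv := by
    rintro ⟨v, y⟩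
    have h : corner (k := k) (F := F) ⟨⟨border v.1.1 (v.1.1 *ᵥ snocZero y), by
        rw [det_border, v.1.2]⟩, mem_commSL.2 (isStrictUnipotent_border.2 ⟨mem_commSL.1 v.2, by
      rw [(commSL_isUpperUnipotent v).mulVec_last, snocZero_last]⟩)⟩ = v := by
      refine Subtype.ext (Subtype.ext ?_)
      ext i j
      simp [corner]
    refine Prod.ext h ?_
    simp only
    rw [h]
    ext i
    simp only [border_castSucc_last]
    change ((v⁻¹).1.1 *ᵥ (v.1.1 *ᵥ snocZero y)) i.castSucc = y i
    rw [Matrix.mulVec_mulVec, commSL_inv_mul_val, Matrix.one_mulVec, snocZero_castSucc]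
  right_inv := by
    intro v
    refine Subtype.ext (Subtype.ext ?_)
    have hv := (commSL_isUpperUnipotent v).eq_border
    have hl : v.1.1 (Fin.last k).castSucc (Fin.last _) = 0 := (mem_commSL.1 v.2).2 _ _ (by simp)
    simp only
    rw [snocZero_eq, Matrix.mulVec_mulVec, commSL_mul_inv_val, Matrix.one_mulVec]
    · exact hv.symm
    · rw [(commSL_isUpperUnipotent _).mulVec_last]
      exact hl
  continuous_toFun := by
    have h1 : Continuous fun p : commSL (k + 1) F × (Fin k → F) => p.1.1.1 :=
      continuous_commSL_val.comp continuous_fst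
    have h2 : Continuous fun p : commSL (k + 1) F × (Fin k → F) => p.1.1.1 *ᵥ snocZero p.2 :=
      h1.matrix_mulVec (continuous_snocZero.comp continuous_snd)
    refine Continuous.subtype_mk (Continuous.subtype_mk (continuous_matrix fun i j => ?_) _) _
    refine Fin.lastCases ?_ (fun i => ?_) i <;> refine Fin.lastCases ?_ (fun j => ?_) j
    · simpa using continuous_const
    · simpa using continuous_const
    · simpa using (continuous_pi_iff.1 h2) i
    · simpa using h1.matrix_elem i j
  continuous_invFun := by
    have h1 : Continuous fun v : commSL (k + 2) F => corner v :=
      Continuous.subtype_mk (Continuous.subtype_mk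
        (continuous_commSL_val.matrix_submatrix _ _) _) _
    refine h1.prodMk (continuous_pi fun i => ?_)
    refine continuous_pi_iff.1 ?_ i.castSucc
    refine (continuous_commSL_val.comp h1.inv).matrix_mulVec (continuous_pi fun j => ?_)
    exact continuous_commSL_val.matrix_elem _ _

theorem columnChart_val (p : commSL (k + 1) F × (Fin k → F)) :
    (columnChart k F p).1.1 = border p.1.1.1 (p.1.1.1 *ᵥ snocZero p.2) := rfl

theorem columnChart_mul (p q : commSL (k + 1) F × (Fin k → F)) :
    columnChart k F p * columnChart k F q = columnChart k F (p.1 * q.1,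
      q.2 + fun i => ((q.1⁻¹).1.1 *ᵥ snocZero p.2) i.castSucc) := by
  refine Subtype.ext (Subtype.ext ?_)
  change (columnChart k F p).1.1 * (columnChart k F q).1.1 = _
  have hm : (p.1 * q.1).1.1 = p.1.1.1 * q.1.1.1 := rfl
  rw [columnChart_val, columnChart_val, columnChart_val, border_mul, hm, snocZero_add,
    snocZero_eq, Matrix.mulVec_add, Matrix.mulVec_mulVec, Matrix.mulVec_mulVec, Matrix.mul_assoc,
    commSL_mul_inv_val, Matrix.mul_one]
  rw [(commSL_isUpperUnipotent _).mulVec_last, snocZero_last]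

/-- By `columnChart_mul`, left multiplication translates the corner and then translates `y` by a
vector depending on the corner alone. Such a skew product preserves the product measure. -/
theorem isHaarMeasure_map_columnChart [MeasurableSpace F] [BorelSpace F] (ν : Measure F)
    [ν.IsAddHaarMeasure] [MeasurableSpace (commSL (k + 1) F)] [BorelSpace (commSL (k + 1) F)]
    (μ : Measure (commSL (k + 1) F)) [μ.IsHaarMeasure]
    [MeasurableSpace (commSL (k + 2) F)] [BorelSpace (commSL (k + 2) F)] :
    ((μ.prod (Measure.pi fun _ : Fin k => ν)).map (columnChart k F)).IsHaarMeasure := by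
  set π := Measure.pi fun _ : Fin k => ν with hπ
  have : π.IsAddHaarMeasure := by rw [hπ]; infer_instance
  have : SigmaFinite π := by rw [hπ]; infer_instance
  have hcm : Measurable (columnChart k F) := (columnChart k F).continuous.measurable
  have hinv : ((μ.prod π).map (columnChart k F)).IsMulLeftInvariant := by
    refine ⟨fun g => ?_⟩
    obtain ⟨p, rfl⟩ := (columnChart k F).surjective g
    have hΨ : MeasurePreserving (fun q : commSL (k + 1) F × (Fin k → F) => (p.1 * q.1,
        q.2 + fun i => ((q.1⁻¹).1.1 *ᵥ snocZero p.2) i.castSucc)) (μ.prod π) (μ.prod π) := by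
      refine MeasurePreserving.skew_product (f := fun v => p.1 * v)
        (g := fun v y => y + fun i : Fin k => ((v⁻¹).1.1 *ᵥ snocZero p.2) i.castSucc)
        (measurePreserving_mul_left μ p.1) ?_ ?_
      · refine Continuous.measurable (continuous_snd.add (continuous_pi fun i => ?_))
        refine continuous_pi_iff.1 ?_ i.castSucc
        exact (continuous_commSL_val.comp continuous_fst.inv).matrix_mulVec continuous_const
      · exact Filter.Eventually.of_forall fun v => map_add_right_eq_self π _
    have hg : Measurable fun x : commSL (k + 2) F => columnChart k F p * x :=
      (continuous_const.mul continuous_id).measurable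
    rw [Measure.map_map hg hcm]
    have : (fun x => columnChart k F p * x) ∘ columnChart k F = columnChart k F ∘
        (fun q : commSL (k + 1) F × (Fin k → F) => (p.1 * q.1,
        q.2 + fun i => ((q.1⁻¹).1.1 *ᵥ snocZero p.2) i.castSucc)) := by
      ext1 q
      exact columnChart_mul p q
    rw [this, ← Measure.map_map hcm hΨ.measurable, hΨ.map_eq]
  have hop : ((μ.prod π).map (columnChart k F)).IsOpenPosMeasure :=
    (columnChart k F).continuous.isOpenPosMeasure_map (columnChart k F).surjective
  have hfc : IsFiniteMeasureOnCompacts ((μ.prod π).map (columnChart k F)) :=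
    Measure.IsFiniteMeasureOnCompacts.map _ (columnChart k F)
  exact {}

end Haar

/-! ### The induction over columns. -/

section Weights

variable {F : Type*} [RCLike F] {n k : ℕ}

/-- The sum of the squared norms of the first `l` coordinates. -/
noncomputable def partialNormSq (z : Fin n → F) (l : ℕ) : ℝ :=
  ∑ i : Fin n with i.val < l, ‖z i‖ ^ 2

theorem partialNormSq_eq {l : ℕ} (hl : l ≤ n) (z : Fin n → F) :
    partialNormSq z l = ∑ i : Fin l, ‖z (Fin.castLE hl i)‖ ^ 2 := by
  rw [partialNormSq, Finset.sum_filter, sum_castLE hl _ fun k hk => if_neg (not_lt.2 hk)]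
  exact Finset.sum_congr rfl fun i _ => if_pos i.2

theorem partialNormSq_nonneg (z : Fin n → F) (l : ℕ) : 0 ≤ partialNormSq z l :=
  Finset.sum_nonneg fun _ _ => by positivity

theorem norm_sq_le_partialNormSq (z : Fin n → F) {l : ℕ} {i : Fin n} (hi : i.val < l) :
    ‖z i‖ ^ 2 ≤ partialNormSq z l :=
  Finset.single_le_sum (f := fun i => ‖z i‖ ^ 2) (fun _ _ => by positivity)
    (Finset.mem_filter.2 ⟨Finset.mem_univ i, hi⟩)

theorem half_log_nonneg {x : ℝ} (hx : 0 ≤ x) : 0 ≤ 1 / 2 * Real.log (1 + x) :=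
  mul_nonneg (by norm_num) (Real.log_nonneg (by linarith))

/-- Every added column contributes the logarithm of a number at least one, and the weight `Λ_n`
vanishes as the determinant is one. -/
theorem fundWeight_logA_nonneg (g : GL (Fin n) F)
    (hg : IsUpperUnipotent (g : Matrix (Fin n) (Fin n) F)) {l : ℕ} (hl : l ≤ n) :
    0 ≤ fundWeight n l (logA g) := by
  induction n with
  | zero =>
    obtain rfl : l = 0 := by omega
    rw [fundWeight_zero]
  | succ n ih =>
    rcases hl.lt_or_eq with hl' | rfl
    · have hb := hg.eq_border
      set A := (g : Matrix (Fin (n + 1)) (Fin (n + 1)) F).submatrix Fin.castSucc Fin.castSucc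
      set x := fun i : Fin n => (g : Matrix (Fin (n + 1)) (Fin (n + 1)) F) i.castSucc (Fin.last n)
      have hA : IsUpperUnipotent A := isUpperUnipotent_border.1 (hb ▸ hg)
      have hdet : IsUnit A.det := by rw [hA.det]; exact isUnit_one
      set g' : GL (Fin n) F := Matrix.GeneralLinearGroup.mk'' A hdet with hg'
      have hgA : (g' : Matrix (Fin n) (Fin n) F) = A := rfl
      obtain ⟨nbar, k, h⟩ := iwasawaA_spec g'
      have hx : (g : Matrix (Fin (n + 1)) (Fin (n + 1)) F) =
          border (g' : Matrix (Fin n) (Fin n) F)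
            ((g' : Matrix (Fin n) (Fin n) F) *ᵥ (A⁻¹ *ᵥ x)) := by
        rw [hgA, Matrix.mulVec_mulVec, Matrix.mul_nonsing_inv _ hdet, Matrix.one_mulVec]
        exact hb
      have hln : l ≤ n := Nat.lt_succ_iff.1 hl'
      rw [fundWeight_logA_border h _ hx hln]
      exact add_nonneg (ih g' hA hln) (half_log_nonneg (Finset.sum_nonneg fun _ _ => by positivity))
    · rw [fundWeight_self_logA g hg.det]

/-- The fundamental weight `Λ_l`, evaluated at `log a(v)`. -/
noncomputable def weight (l : ℕ) (v : commSL n F) : ℝ :=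
  fundWeight n l (logA (SpecialLinearGroup.toGL v.1))

theorem weight_nonneg {l : ℕ} (hl : l ≤ n) (v : commSL n F) : 0 ≤ weight l v :=
  fundWeight_logA_nonneg _ (commSL_isUpperUnipotent v) hl

theorem weight_zero (v : commSL n F) : weight 0 v = 0 := fundWeight_zero _

theorem weight_self (v : commSL n F) : weight n v = 0 :=
  fundWeight_self_logA _ (commSL_isUpperUnipotent v).det

theorem continuous_weight {l : ℕ} (hl : l ≤ n) :
    Continuous fun v : commSL n F => weight l v := by
  unfold weight
  simp_rw [fundWeight_logA _ hl]
  refine continuous_const.mul (Continuous.log (Continuous.norm (Continuous.matrix_det ?_))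
    fun v => ?_)
  · exact (continuous_commSL_val.matrix_mul
      continuous_commSL_val.matrix_conjTranspose).matrix_submatrix _ _
  · rw [norm_det_gram_eq_exp]
    positivity

theorem weight_columnChart (v : commSL (k + 1) F) (y : Fin k → F)
    {nbar K : Matrix (Fin (k + 1)) (Fin (k + 1)) F}
    (h : IsIwasawa v.1.1 nbar (iwasawaA (SpecialLinearGroup.toGL v.1)) K) {l : ℕ}
    (hl : l ≤ k + 1) :
    weight l (columnChart k F (v, y)) = weight l v +
      1 / 2 * Real.log (1 + partialNormSq (K *ᵥ snocZero y) l) := by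
  rw [partialNormSq_eq hl]
  exact fundWeight_logA_border (g := SpecialLinearGroup.toGL v.1) h (snocZero y) rfl hl

theorem prod_bracket_eq {κ : ℝ} (z : Fin k → F) : ∏ i, bracket κ (z i) =
    ENNReal.ofReal (Real.exp (-(((Module.finrank ℝ F : ℝ) + κ) *
      ∑ i, 1 / 2 * Real.log (1 + ‖z i‖ ^ 2)))) := by
  unfold bracket
  rw [← ENNReal.ofReal_prod_of_nonneg fun i _ => by positivity, Finset.mul_sum,
    ← Finset.sum_neg_distrib, Real.exp_sum]
  congr 1
  refine Finset.prod_congr rfl fun i _ => ?_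
  rw [Real.rpow_def_of_pos (by positivity)]
  congr 1
  ring

theorem exp_neg_le_min {ε b : ℝ} (hε : 0 < ε) (hb : 0 ≤ b) (x : F)
    (hx : ‖x‖ ≤ Real.exp b) :
    ENNReal.ofReal (Real.exp (-(ε * b))) ≤ min 1 (‖x‖ₑ ^ (-ε)) := by
  refine le_min ?_ ?_
  · rw [ENNReal.ofReal_le_one, Real.exp_le_one_iff]
    have := mul_nonneg hε.le hb
    linarith
  · have e : Real.exp (-(ε * b)) = Real.exp b ^ (-ε) := by
      rw [← Real.exp_mul]; congr 1; ring
    rw [e, ← ENNReal.ofReal_rpow_of_pos (Real.exp_pos b), ENNReal.rpow_neg, ENNReal.rpow_neg,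
      ENNReal.inv_le_inv]
    refine ENNReal.rpow_le_rpow ?_ hε.le
    rw [← ofReal_norm]
    exact ENNReal.ofReal_le_ofReal hx

/-- The partial norm of length `i + 1` dominates `|z_i|²`, which gives each of the first `k`
coordinates the exponent `d(1-η)`. The top term `δ` is split: `ε` pays for the last coordinate, and
`δ - ε = 2(k+1)κ` adds `2κ` to each of the others. Since `dη ≤ κ`, the total is at least the
integrable exponent `d + κ`. -/
theorem exp_partialNormSq_le {η δ ε κ : ℝ} (hε : 0 < ε) (hκ : 0 < κ) (hη1 : η ≤ 1)
    (hη : (Module.finrank ℝ F : ℝ) * η ≤ κ) (hδ : 2 * (k + 1) * κ = δ - ε)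
    (z : Fin (k + 1) → F) :
    ENNReal.ofReal (Real.exp (-((Module.finrank ℝ F : ℝ) * (1 - η) *
        ∑ l ∈ Finset.range (k + 1), 1 / 2 * Real.log (1 + partialNormSq z l) +
        δ * (1 / 2 * Real.log (1 + partialNormSq z (k + 1)))))) ≤
      (∏ i : Fin k, bracket κ (z i.castSucc)) * min 1 (‖z (Fin.last k)‖ₑ ^ (-ε)) := by
  set d : ℝ := (Module.finrank ℝ F : ℝ) with hd
  have hd0 : 0 ≤ d := Nat.cast_nonneg _
  set b := 1 / 2 * Real.log (1 + partialNormSq z (k + 1)) with hb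
  have hb0 : 0 ≤ b := half_log_nonneg (partialNormSq_nonneg z _)
  set a : Fin k → ℝ := fun i => 1 / 2 * Real.log (1 + ‖z i.castSucc‖ ^ 2) with ha
  have hal : ∀ (i : Fin k) (l : ℕ), i.val < l →
      a i ≤ 1 / 2 * Real.log (1 + partialNormSq z l) := by
    intro i l hil
    have := norm_sq_le_partialNormSq z (l := l) (i := i.castSucc) hil
    refine mul_le_mul_of_nonneg_left (Real.log_le_log (by positivity) ?_) (by norm_num)
    linarith
  have hsum1 : ∑ i, a i ≤
      ∑ l ∈ Finset.range (k + 1), 1 / 2 * Real.log (1 + partialNormSq z l) := by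
    rw [Finset.sum_range_succ', ← Fin.sum_univ_eq_sum_range
      (fun l => 1 / 2 * Real.log (1 + partialNormSq z (l + 1)))]
    have h1 := half_log_nonneg (partialNormSq_nonneg z 0)
    have h2 : ∑ i, a i ≤ ∑ i : Fin k, 1 / 2 * Real.log (1 + partialNormSq z (i.val + 1)) :=
      Finset.sum_le_sum fun i _ => hal i _ (Nat.lt_succ_self _)
    linarith
  have hsum2 : ∑ i, a i ≤ (k + 1) * b := by
    have h2 : ∑ i, a i ≤ ∑ _i : Fin k, b := Finset.sum_le_sum fun i _ => hal i _ (by omega)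
    simp at h2
    linarith
  have ha0 : 0 ≤ ∑ i, a i := Finset.sum_nonneg fun i _ => half_log_nonneg (by positivity)
  have hlast : ‖z (Fin.last k)‖ ≤ Real.exp b := by
    have h1 : ‖z (Fin.last k)‖ ^ 2 ≤ Real.exp b ^ 2 := by
      have h2 : Real.exp b ^ 2 = 1 + partialNormSq z (k + 1) := by
        rw [← Real.exp_nat_mul, hb]
        push_cast
        rw [← mul_assoc, show (2 : ℝ) * (1 / 2) = 1 by norm_num, one_mul,
          Real.exp_log (by have := partialNormSq_nonneg z (k + 1); linarith)]
      rw [h2]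
      have := norm_sq_le_partialNormSq z (l := k + 1) (i := Fin.last k) (by simp)
      linarith
    exact (sq_le_sq₀ (norm_nonneg _) (Real.exp_pos b).le).1 h1
  refine le_trans ?_ (mul_le_mul_right (exp_neg_le_min hε hb0 _ hlast) _)
  rw [prod_bracket_eq, ← ENNReal.ofReal_mul (Real.exp_pos _).le, ← Real.exp_add]
  refine ENNReal.ofReal_le_ofReal (Real.exp_le_exp.2 ?_)
  have h1 : d * (1 - η) * ∑ i, a i ≤ d * (1 - η) *
      ∑ l ∈ Finset.range (k + 1), 1 / 2 * Real.log (1 + partialNormSq z l) :=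
    mul_le_mul_of_nonneg_left hsum1 (mul_nonneg hd0 (by linarith))
  have h2 : 2 * κ * ∑ i, a i ≤ (δ - ε) * b := by
    rw [← hδ]
    calc _ ≤ 2 * κ * ((k + 1) * b) := mul_le_mul_of_nonneg_left hsum2 (by linarith)
      _ = _ := by ring
  have h3 : d * η * ∑ i, a i ≤ κ * ∑ i, a i := mul_le_mul_of_nonneg_right hη ha0
  linarith

theorem finrank_pos : (0 : ℝ) < Module.finrank ℝ F := by
  exact_mod_cast Module.finrank_pos

theorem one_le_finrank : (1 : ℝ) ≤ Module.finrank ℝ F := by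
  exact_mod_cast (Module.finrank_pos : 0 < Module.finrank ℝ F)

/-- Integrating out the column costs `t^(-(d-ε)) = exp((d-ε) Λ_k(v))`, against the decay
`exp(-d(1-η) Λ_k(v))` carried by the corner; what survives is the exponent `ε - dη`. -/
theorem exists_lintegral_columnChart_le [MeasurableSpace F] [BorelSpace F] (ν : Measure F)
    [ν.IsAddHaarMeasure] (k : ℕ) {η δ ε κ : ℝ} (hε : 0 < ε) (hε1 : ε < 1) (hκ : 0 < κ)
    (hη1 : η ≤ 1) (hη : (Module.finrank ℝ F : ℝ) * η ≤ κ) (hδ : 2 * (k + 1) * κ = δ - ε) :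
    ∃ C : ENNReal, C ≠ ⊤ ∧ ∀ v : commSL (k + 1) F,
      ∫⁻ y, ENNReal.ofReal (Real.exp (-((Module.finrank ℝ F : ℝ) * (1 - η) *
        ∑ l ∈ Finset.range (k + 1), weight l (columnChart k F (v, y)) +
        δ * weight (k + 1) (columnChart k F (v, y))))) ∂(Measure.pi fun _ => ν) ≤
      C * ENNReal.ofReal (Real.exp (-((Module.finrank ℝ F : ℝ) * (1 - η) *
        ∑ l ∈ Finset.range k, weight l v + (ε - (Module.finrank ℝ F : ℝ) * η) * weight k v))) := by
  obtain ⟨C, hC, h⟩ := exists_lintegral_mulVec_le ν hκ hε hε1 k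
  refine ⟨C, hC, fun v => ?_⟩
  set d : ℝ := (Module.finrank ℝ F : ℝ) with hd
  have hv := commSL_isUpperUnipotent v
  obtain ⟨nbar, K, hK⟩ := iwasawaA_spec (SpecialLinearGroup.toGL v.1)
  have hK' : IsIwasawa v.1.1 nbar (iwasawaA (SpecialLinearGroup.toGL v.1)) K := hK
  set t := iwasawaA (SpecialLinearGroup.toGL v.1) (Fin.last k) with ht
  have htp : 0 < t := iwasawaA_pos _ _
  have htw : t = Real.exp (-weight k v) := (exp_neg_fundWeight_logA _ hv.det).symm
  set E := Real.exp (-(d * (1 - η) * ∑ l ∈ Finset.range (k + 1), weight l v)) with hE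
  have hpt : ∀ y : Fin k → F, ENNReal.ofReal (Real.exp (-(d * (1 - η) *
        ∑ l ∈ Finset.range (k + 1), weight l (columnChart k F (v, y)) +
        δ * weight (k + 1) (columnChart k F (v, y))))) ≤
      ENNReal.ofReal E * ((∏ i, bracket κ ((topLeft k.le_succ K *ᵥ y) i)) *
        min 1 ((‖(fun i : Fin k => -star (K i.castSucc (Fin.last k))) ⬝ᵥ
          (topLeft k.le_succ K *ᵥ y)‖ₑ / ENNReal.ofReal t) ^ (-ε))) := by
    intro y
    have e1 : ∑ l ∈ Finset.range (k + 1), weight l (columnChart k F (v, y)) =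
        ∑ l ∈ Finset.range (k + 1), weight l v + ∑ l ∈ Finset.range (k + 1),
          1 / 2 * Real.log (1 + partialNormSq (K *ᵥ snocZero y) l) := by
      rw [← Finset.sum_add_distrib]
      exact Finset.sum_congr rfl fun l hl =>
        weight_columnChart v y hK' (Finset.mem_range.1 hl).le
    have e2 : ‖(K *ᵥ snocZero y) (Fin.last k)‖ₑ =
        ‖(fun i : Fin k => -star (K i.castSucc (Fin.last k))) ⬝ᵥ
          (topLeft k.le_succ K *ᵥ y)‖ₑ / ENNReal.ofReal t := by
      rw [← ofReal_norm, snocZero, hK'.norm_mulVec_last hv, ENNReal.ofReal_div_of_pos htp,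
        ofReal_norm]
    have e3 : ∀ i : Fin k, (K *ᵥ snocZero y) i.castSucc = (topLeft k.le_succ K *ᵥ y) i :=
      mulVec_snoc_castSucc K y
    have hb := exp_partialNormSq_le hε hκ hη1 hη hδ (K *ᵥ snocZero y)
    rw [e2] at hb
    simp only [e3] at hb
    refine le_trans (le_of_eq ?_) (mul_le_mul_right hb _)
    -- The corner lies in `SL(k+1, F)`, so it contributes nothing to `Λ_{k+1}`; the `δ`-term comes
    -- from the column alone.
    rw [← ENNReal.ofReal_mul (Real.exp_pos _).le, ← Real.exp_add, e1,
      weight_columnChart v y hK' le_rfl, weight_self, ← hd]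
    congr 2
    ring
  refine (lintegral_mono hpt).trans ?_
  rw [lintegral_const_mul' _ _ ENNReal.ofReal_ne_top]
  refine (mul_le_mul_right (h _ t _ htp (hK'.det_topLeft_unitary hv) (hK'.sum_norm_sq hv)) _).trans
    (le_of_eq ?_)
  rw [mul_left_comm, ← ENNReal.ofReal_mul (Real.exp_pos _).le, htw, ← Real.exp_mul,
    ← Real.exp_add, Finset.sum_range_succ]
  congr 3
  ring

theorem subsingleton_commSL (hn : n ≤ 1) : Subsingleton (commSL n F) := by
  refine ⟨fun v w => Subtype.ext (Subtype.ext ?_)⟩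
  have : Subsingleton (Fin n) := Fin.subsingleton_iff_le_one.2 hn
  ext i j
  rw [Subsingleton.elim j i, (commSL_isUpperUnipotent v).1, (commSL_isUpperUnipotent w).1]

theorem exists_lintegral_weight_lt_top (F : Type*) [RCLike F] (k : ℕ) : ∀ δ : ℝ, 0 < δ →
    ∃ η : ℝ, 0 < η ∧ η ≤ 1 ∧
    ∀ [MeasurableSpace (commSL (k + 1) F)] [BorelSpace (commSL (k + 1) F)]
      (μ : Measure (commSL (k + 1) F)) [μ.IsHaarMeasure],
      ∫⁻ v, ENNReal.ofReal (Real.exp (-((Module.finrank ℝ F : ℝ) * (1 - η) *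
        ∑ l ∈ Finset.range k, weight l v + δ * weight k v))) ∂μ < ⊤ := by
  induction k with
  | zero =>
    intro δ hδ
    refine ⟨1, one_pos, le_rfl, ?_⟩
    intro _ _ μ _
    have := subsingleton_commSL (F := F) (n := 0 + 1) le_rfl
    have : IsFiniteMeasure μ := CompactSpace.isFiniteMeasure
    simp [weight_zero]
  | succ k ih =>
    intro δ hδ
    set d : ℝ := (Module.finrank ℝ F : ℝ) with hd
    have hd1 : 1 ≤ d := one_le_finrank
    set ε := min (δ / 2) (1 / 2) with hεdef
    have hε : 0 < ε := by rw [hεdef]; positivity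
    have hε1 : ε < 1 := lt_of_le_of_lt (min_le_right _ _) (by norm_num)
    have hεδ : ε ≤ δ / 2 := min_le_left _ _
    set κ := (δ - ε) / (2 * (k + 1)) with hκdef
    have hκ : 0 < κ := div_pos (by linarith) (by positivity)
    have hκδ : 2 * (k + 1) * κ = δ - ε := by rw [hκdef]; field_simp
    obtain ⟨η', hη', hη'1, hfin⟩ := ih (ε / 2) (by linarith)
    -- The three bounds serve to compare with the induction hypothesis, to keep `ε - dη ≥ ε/2` for
    -- `Λ_k` of the corner, and to meet `dη ≤ κ` in the column estimate.
    set η := min η' (min (ε / (2 * d)) (κ / d)) with hηdef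
    have hη : 0 < η := by rw [hηdef]; positivity
    have hηη : η ≤ η' := min_le_left _ _
    have hη1 : η ≤ 1 := hηη.trans hη'1
    have hηε : d * η ≤ ε / 2 := by
      have h1 : η ≤ ε / (2 * d) := (min_le_right _ _).trans (min_le_left _ _)
      calc d * η ≤ d * (ε / (2 * d)) := mul_le_mul_of_nonneg_left h1 (by linarith)
        _ = ε / 2 := by field_simp
    have hηκ : d * η ≤ κ := by
      have h1 : η ≤ κ / d := (min_le_right _ _).trans (min_le_right _ _)
      calc d * η ≤ d * (κ / d) := mul_le_mul_of_nonneg_left h1 (by linarith)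
        _ = κ := by field_simp
    refine ⟨η, hη, hη1, ?_⟩
    intro _ _ μ' _
    let _ : MeasurableSpace (commSL (k + 1) F) := borel _
    have _ : BorelSpace (commSL (k + 1) F) := ⟨rfl⟩
    set μ : Measure (commSL (k + 1) F) := Measure.haar with hμ
    set ν : Measure F := Measure.addHaar with hν
    have hH := isHaarMeasure_map_columnChart (k := k) ν μ
    have hm : Continuous fun v : commSL (k + 2) F => ENNReal.ofReal (Real.exp (-(d * (1 - η) *
        ∑ l ∈ Finset.range (k + 1), weight l v + δ * weight (k + 1) v))) := by
      refine ENNReal.continuous_ofReal.comp (Real.continuous_exp.comp (Continuous.neg ?_))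
      refine (continuous_const.mul (continuous_finsetSum _ fun l hl => ?_)).add
        (continuous_const.mul (continuous_weight (by omega)))
      exact continuous_weight (by have := Finset.mem_range.1 hl; omega)
    -- By uniqueness of Haar measure it is enough to treat the product measure carried over by the
    -- chart.
    rw [Measure.isMulLeftInvariant_eq_smul μ' ((μ.prod (Measure.pi fun _ => ν)).map (columnChart k F)),
      lintegral_smul_measure]
    refine ENNReal.mul_lt_top ENNReal.coe_lt_top ?_
    rw [lintegral_map hm.measurable (columnChart k F).continuous.measurable,
      lintegral_prod]
    swap
    · exact (hm.comp (columnChart k F).continuous).measurable.aemeasurable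
    obtain ⟨C, hC, hbound⟩ := exists_lintegral_columnChart_le ν k hε hε1 hκ hη1 hηκ hκδ
    refine lt_of_le_of_lt (lintegral_mono hbound) ?_
    rw [lintegral_const_mul' _ _ hC]
    refine ENNReal.mul_lt_top hC.lt_top (lt_of_le_of_lt (lintegral_mono fun v => ?_) (hfin μ))
    refine ENNReal.ofReal_le_ofReal (Real.exp_le_exp.2 (neg_le_neg (add_le_add ?_ ?_)))
    · refine mul_le_mul_of_nonneg_right (mul_le_mul_of_nonneg_left (by linarith) (by linarith)) ?_
      exact Finset.sum_nonneg fun l hl =>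
        weight_nonneg (by have := Finset.mem_range.1 hl; omega) v
    · exact mul_le_mul_of_nonneg_right (by linarith) (weight_nonneg (by omega) v)

end Weights

/-! ### From weights to `ρ`, and from `SL` to `GL`. -/

section Tame

variable {F : Type*} [RCLike F] {n : ℕ}

theorem sum_range_fundWeight (H : Fin n → ℝ) :
    ∑ l ∈ Finset.range n, fundWeight n l H = ∑ i, ∑ j, if i < j then H i else 0 := by
  rw [← Fin.sum_univ_eq_sum_range fun l => fundWeight n l H, Finset.sum_comm]
  refine Finset.sum_congr rfl fun j _ => ?_
  rw [fundWeight, LinearMap.sum_apply, Finset.sum_filter]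
  rfl

/-- On trace zero matrices, `ρ` is `dim_ℝ F` times the sum of the fundamental weights. -/
theorem rho_eq_sum_fundWeight (H : Fin n → ℝ) (hH : fundWeight n n H = 0) :
    rho n F H = (Module.finrank ℝ F : ℝ) * ∑ l ∈ Finset.range n, fundWeight n l H := by
  have hH' : ∑ i, H i = 0 := by
    rw [fundWeight_apply le_rfl] at hH
    simpa using hH
  have h1 : rho n F H = 1 / 2 * ((Module.finrank ℝ F : ℝ) *
      ((∑ i, ∑ j, if i < j then H i else 0) - ∑ i, ∑ j, if i < j then H j else 0)) := by
    rw [rho, LinearMap.smul_apply, LinearMap.sum_apply, Finset.sum_filter, smul_eq_mul,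
      Fintype.sum_prod_type]
    congr 1
    rw [← Finset.sum_sub_distrib, Finset.mul_sum]
    refine Finset.sum_congr rfl fun i _ => ?_
    rw [← Finset.sum_sub_distrib, Finset.mul_sum]
    refine Finset.sum_congr rfl fun j _ => ?_
    by_cases hij : i < j <;> simp [hij]
  -- After exchanging indices in the second sum, the three sums of `H i` run over `i < j`, `j < i`
  -- and `i = j`, hence over all pairs. By trace zero the first two sums are therefore opposite.
  have h2 : (∑ i, ∑ j, if i < j then H i else 0) + (∑ i, ∑ j, if i < j then H j else 0) +
      ∑ i, H i = ∑ i : Fin n, ∑ _j : Fin n, H i := by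
    rw [Finset.sum_comm (f := fun i j => if i < j then H j else 0), ← Finset.sum_add_distrib,
      ← Finset.sum_add_distrib]
    refine Finset.sum_congr rfl fun i _ => ?_
    have h3 : H i = ∑ j, if i = j then H i else 0 := by simp
    refine (congrArg (_ + ·) h3).trans ?_
    rw [← Finset.sum_add_distrib, ← Finset.sum_add_distrib]
    refine Finset.sum_congr rfl fun j _ => ?_
    rcases lt_trichotomy i j with hij | rfl | hij
    · simp [hij, hij.not_gt, hij.ne]
    · simp
    · simp [hij, hij.not_gt, hij.ne']
  have h4 : ∑ i : Fin n, ∑ _j : Fin n, H i = 0 := by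
    rw [Finset.sum_comm]; simp [hH']
  rw [h1, sum_range_fundWeight]
  rw [h4, hH', add_zero] at h2
  rw [eq_neg_of_add_eq_zero_right h2]
  ring

theorem exists_one_add_rpow_le (r : ℝ) {θ : ℝ} (hθ : 0 < θ) :
    ∃ C : ℝ, 0 < C ∧ ∀ s : ℝ, 0 ≤ s → (1 + s) ^ r ≤ C * Real.exp (θ * s) := by
  -- `τ ≤ 1` gives `1 + s ≤ τ⁻¹ exp(τ s)`, and `τ |r| ≤ θ` controls the `|r|`-th power of this.
  set τ := min 1 (θ / (|r| + 1)) with hτ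
  have hr : 0 < |r| + 1 := by positivity
  have hτ0 : 0 < τ := by rw [hτ]; positivity
  have hτ1 : τ ≤ 1 := min_le_left _ _
  have hτr : τ * |r| ≤ θ := by
    have h1 : τ * (|r| + 1) ≤ θ := (le_div_iff₀ hr).1 (min_le_right _ _)
    nlinarith
  refine ⟨τ⁻¹ ^ |r|, by positivity, fun s hs => ?_⟩
  have h1 : 1 + s ≤ τ⁻¹ * Real.exp (τ * s) := by
    rw [inv_mul_eq_div, le_div_iff₀ hτ0]
    have := Real.add_one_le_exp (τ * s)
    nlinarith
  calc (1 + s) ^ r ≤ (1 + s) ^ |r| :=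
        Real.rpow_le_rpow_of_exponent_le (by linarith) (le_abs_self r)
    _ ≤ (τ⁻¹ * Real.exp (τ * s)) ^ |r| :=
        Real.rpow_le_rpow (by linarith) h1 (abs_nonneg r)
    _ = τ⁻¹ ^ |r| * Real.exp (τ * |r| * s) := by
        rw [Real.mul_rpow (by positivity) (Real.exp_pos _).le, ← Real.exp_mul]
        congr 2; ring
    _ ≤ _ := by gcongr

theorem rho_logA (v : commSL n F) : rho n F (logA (SpecialLinearGroup.toGL v.1)) =
    (Module.finrank ℝ F : ℝ) * ∑ l ∈ Finset.range n, weight l v :=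
  rho_eq_sum_fundWeight _ (weight_self v)

theorem sum_weight_nonneg (v : commSL n F) {m : ℕ} (hm : m ≤ n) :
    0 ≤ ∑ l ∈ Finset.range m, weight l v :=
  Finset.sum_nonneg fun l hl => weight_nonneg (by have := Finset.mem_range.1 hl; omega) v

theorem continuous_sum_weight {m : ℕ} (hm : m ≤ n) :
    Continuous fun v : commSL n F => ∑ l ∈ Finset.range m, weight l v :=
  continuous_finsetSum _ fun l hl =>
    continuous_weight (by have := Finset.mem_range.1 hl; omega)

theorem integrable_aPow_mul_rpow [MeasurableSpace (commSL n F)] [BorelSpace (commSL n F)]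
    (μ : Measure (commSL n F)) [μ.IsHaarMeasure] {α : ℝ} (hα : α < 1) (r : ℝ) :
    Integrable (fun v : commSL n F =>
      aPow (SpecialLinearGroup.toGL v.1) (-rho n F) *
        aPow (SpecialLinearGroup.toGL v.1)
          ((α * (Module.finrank ℝ F : ℝ)) • fundWeight n (n - 1)) *
        (1 + rho n F (logA (SpecialLinearGroup.toGL v.1))) ^ r) μ := by
  cases n with
  | zero =>
    have := subsingleton_commSL (F := F) (n := 0) zero_le_one
    have : IsFiniteMeasure μ := CompactSpace.isFiniteMeasure
    exact Integrable.of_finite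
  | succ k =>
    set d : ℝ := (Module.finrank ℝ F : ℝ) with hd
    have hd0 : 0 < d := finrank_pos
    -- The factor with `α` leaves the decay `d(1-α)` in the top weight `Λ_k`. Half of it serves as
    -- `δ`; the other half, with the slack `η` in the lower weights, absorbs the power of `1 + ρ`.
    obtain ⟨η, hη, hη1, hfin⟩ := exists_lintegral_weight_lt_top F k (d * (1 - α) / 2)
      (by have : 0 < 1 - α := by linarith
          positivity)
    set θ := min η ((1 - α) / 2) with hθdef
    have hθ : 0 < θ := lt_min hη (by linarith)
    have hθη : θ ≤ η := min_le_left _ _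
    have hθα : θ ≤ (1 - α) / 2 := min_le_right _ _
    obtain ⟨C, hC, hbound⟩ := exists_one_add_rpow_le r hθ
    have hcont : Continuous fun v : commSL (k + 1) F =>
        -(d * (1 - η) * ∑ l ∈ Finset.range k, weight l v + d * (1 - α) / 2 * weight k v) :=
      ((continuous_const.mul (continuous_sum_weight k.le_succ)).add
        (continuous_const.mul (continuous_weight k.le_succ))).neg
    have hg : Integrable (fun v : commSL (k + 1) F => Real.exp (-(d * (1 - η) *
        ∑ l ∈ Finset.range k, weight l v + d * (1 - α) / 2 * weight k v))) μ := by
      refine ⟨(Real.continuous_exp.comp hcont).measurable.aestronglyMeasurable, ?_⟩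
      rw [hasFiniteIntegral_iff_ofReal (Filter.Eventually.of_forall fun v => (Real.exp_pos _).le)]
      exact hfin μ
    have e : ∀ v : commSL (k + 1) F, aPow (SpecialLinearGroup.toGL v.1) (-rho (k + 1) F) *
        aPow (SpecialLinearGroup.toGL v.1) ((α * d) • fundWeight (k + 1) (k + 1 - 1)) *
        (1 + rho (k + 1) F (logA (SpecialLinearGroup.toGL v.1))) ^ r =
        Real.exp (-(d * ∑ l ∈ Finset.range (k + 1), weight l v)) *
          Real.exp (α * d * weight k v) *
          (1 + d * ∑ l ∈ Finset.range (k + 1), weight l v) ^ r := by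
      intro v
      rw [aPow, aPow, LinearMap.neg_apply, LinearMap.smul_apply, rho_logA, smul_eq_mul]
      rfl
    simp_rw [e]
    have hs0 : ∀ v : commSL (k + 1) F, 0 ≤ d * ∑ l ∈ Finset.range (k + 1), weight l v :=
      fun v => mul_nonneg hd0.le (sum_weight_nonneg v le_rfl)
    refine (hg.const_mul C).mono' ?_ (Filter.Eventually.of_forall fun v => ?_)
    · have h1 := (continuous_const (y := d)).mul (continuous_sum_weight (n := k + 1) (F := F) le_rfl)
      have h2 := continuous_weight (n := k + 1) (F := F) (l := k) k.le_succ
      refine Continuous.aestronglyMeasurable ?_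
      refine ((Real.continuous_exp.comp h1.neg).mul
        (Real.continuous_exp.comp (continuous_const.mul h2))).mul
        ((continuous_const.add h1).rpow_const fun v => Or.inl ?_)
      have := hs0 v
      exact (by linarith : (0:ℝ) < 1 + d * ∑ l ∈ Finset.range (k + 1), weight l v).ne'
    · have hs := hs0 v
      rw [Real.norm_of_nonneg (mul_nonneg (by positivity) (Real.rpow_nonneg (by linarith) r))]
      set s := d * ∑ l ∈ Finset.range (k + 1), weight l v with hsdef
      calc _ ≤ Real.exp (-s) * Real.exp (α * d * weight k v) * (C * Real.exp (θ * s)) :=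
            mul_le_mul_of_nonneg_left (hbound s hs) (by positivity)
        _ = C * Real.exp (-s + α * d * weight k v + θ * s) := by
            rw [Real.exp_add, Real.exp_add]; ring
        _ ≤ _ := by
            refine mul_le_mul_of_nonneg_left (Real.exp_le_exp.2 ?_) hC.le
            rw [hsdef, Finset.sum_range_succ]
            have h1 := sum_weight_nonneg v k.le_succ
            have h2 := weight_nonneg k.le_succ v
            have h3 : d * θ * ∑ l ∈ Finset.range k, weight l v ≤
                d * η * ∑ l ∈ Finset.range k, weight l v := by gcongr
            have h4 : d * θ * weight k v ≤ d * ((1 - α) / 2) * weight k v := by gcongr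
            linarith

theorem isTameSL (n : ℕ) (F : Type*) [RCLike F] : IsTameSL n F := by
  intro _ _ μ _ r _
  refine (integrable_aPow_mul_rpow μ zero_lt_one r).congr
    (Filter.Eventually.of_forall fun v => ?_)
  simp [aPow]

theorem map_upperUnipotentSL :
    (upperUnipotentSL n F).map SpecialLinearGroup.toGL = upperUnipotentGL n F := by
  refine le_antisymm (Subgroup.map_comap_le _ _) fun g hg => ?_
  have hg' : IsUpperUnipotent (g : Matrix (Fin n) (Fin n) F) := hg
  exact ⟨⟨(g : Matrix (Fin n) (Fin n) F), hg'.det⟩, hg, Units.ext rfl⟩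

theorem map_commSL : (commSL n F).map SpecialLinearGroup.toGL = commGL n F := by
  rw [commSL, Subgroup.map_commutator, map_upperUnipotentSL]

/-- The commutator subgroups in `SL(n, F)` and `GL(n, F)` are the same group. -/
noncomputable def commEquiv (n : ℕ) (F : Type*) [RCLike F] : commSL n F ≃* commGL n F :=
  ((commSL n F).equivMapOfInjective SpecialLinearGroup.toGL
    SpecialLinearGroup.toGL_injective).trans
    (MulEquiv.subgroupCongr map_commSL)

theorem commEquiv_val (v : commSL n F) :
    (commEquiv n F v).1 = SpecialLinearGroup.toGL v.1 := rfl

theorem toGL_commEquiv_symm (v : commGL n F) :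
    SpecialLinearGroup.toGL ((commEquiv n F).symm v).1 = v.1 := by
  rw [← commEquiv_val, MulEquiv.apply_symm_apply]

theorem continuous_commEquiv : Continuous (commEquiv n F) :=
  Continuous.subtype_mk (SpecialLinearGroup.continuous_toGL.comp continuous_subtype_val) _

theorem continuous_commEquiv_symm : Continuous (commEquiv n F).symm := by
  rw [isClosedEmbedding_commSL.isInducing.continuous_iff]
  have : (fun v : commSL n F => (v.1.1 : Matrix (Fin n) (Fin n) F)) ∘ (commEquiv n F).symm =
      fun v : commGL n F => (v.1 : Matrix (Fin n) (Fin n) F) := by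
    ext1 v
    exact congrArg Units.val (toGL_commEquiv_symm v)
  rw [this]
  exact Units.continuous_val.comp continuous_subtype_val

/-- Unipotent matrices have determinant one, so both groups have the same `N` and the same `[N, N]`,
with the same topology. Haar measure and integrand carry over along `commEquiv`. -/
theorem isTameGL (n : ℕ) (F : Type*) [RCLike F] : IsTameGL n F := by
  intro _ _ μ _ r hr
  let _ : MeasurableSpace (commSL n F) := borel _
  have _ : BorelSpace (commSL n F) := ⟨rfl⟩
  have hH : (μ.map (commEquiv n F).symm).IsHaarMeasure :=
    (commEquiv n F).symm.isHaarMeasure_map μ continuous_commEquiv_symm continuous_commEquiv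
  let e : commGL n F ≃ₜ commSL n F :=
    ⟨(commEquiv n F).symm.toEquiv, continuous_commEquiv_symm, continuous_commEquiv⟩
  have h := isTameSL n F (μ.map (commEquiv n F).symm) r hr
  have h2 := (e.measurableEmbedding.integrable_map_iff (μ := μ)).1 h
  refine h2.congr (Filter.Eventually.of_forall fun v => ?_)
  have hv : SpecialLinearGroup.toGL (e v).1 = v.1 := toGL_commEquiv_symm v
  simp only [Function.comp_apply, hv]

end Tame

end SLTame

theorem mainTheorem1 (F : Type*) [RCLike F] (n : ℕ) :
    (3 ≤ n →
      ∀ [MeasurableSpace (SLTame.commSL n F)]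
        [BorelSpace (SLTame.commSL n F)]
        (μ : Measure (SLTame.commSL n F))
        [μ.IsHaarMeasure] (α : ℝ), 0 ≤ α → α < 1 → ∀ r : ℝ,
        Integrable (fun v : (SLTame.commSL n F) =>
          SLTame.aPow (SpecialLinearGroup.toGL v.1) (-SLTame.rho n F) *
          SLTame.aPow (SpecialLinearGroup.toGL v.1)
            ((α * (Module.finrank ℝ F : ℝ)) • SLTame.fundWeight n (n - 1)) *
          (1 + SLTame.rho n F (SLTame.logA (SpecialLinearGroup.toGL v.1))) ^ r) μ) ∧
    SLTame.IsTameSL n F ∧ SLTame.IsTameGL n F := by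
  refine ⟨?_, SLTame.isTameSL n F, SLTame.isTameGL n F⟩
  intro _ _ _ μ _ α _ hα r
  exact SLTame.integrable_aPow_mul_rpow μ hα r
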